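/- **Setting.** Let $\mathbb K$ be an algebraically closed field of characteristic zero, $N\ge 1$, $M\geq 0$, and let $\omega\in\mathbb R^N$ have rationally independent coordinates. $\mathcal S_\omega$ is the ring of $\omega$-positive Puiseux series: the series $\varphi=\sum_{\alpha\in\mathbb Q^N}c_\alpha x^\alpha$ ($c_\alpha\in\mathbb K$) whose set of exponents $\{\alpha: c_\alpha\ne0\}$ lies in $\frac1k\mathbb Z^N$ for some integer $k\geq 1$ and has a translate by a vector of $\mathbb Q^N$ contained in a cone $\sigma$ generated by finitely many vectors of $\mathbb Q^N$ with $\omega\cdot v\ge 0$ for all $v\in\sigma$. Write $\mathbb K[x^*,y]=\mathbb K[x_1^{\pm1},\dots,x_N^{\pm1},y_1,\dots,y_M]$. An ideal $\mathcal I\subset\mathbb K[x^*,y]$ is *$N$-admissible* if the projection to $\mathbb K^N$ (the $x$-coordinates) of the zero set in $\mathbb K^{N+M}$ of $\mathcal I\cap\mathbb K[x,y]$ is dominant with finite generic fibre. An *$\omega$-solution* of $\mathcal I$ is $\phi\in\mathcal S_\omega^M$ with $f(x,\phi(x))=0$ for all $f\in\mathcal I$. **Initial ideals.** Put $\infty\cdot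 0=0$ and $\infty\cdot a=\infty$ for $a\in\mathbb R\setminus\{0\}$. Let $\eta\in(\mathbb R\cup\{\infty\})^M$ and $\Lambda(\eta)=\{i:\eta_i\neq\infty\}$. The order of $f=\sum a_{\alpha,\beta}x^\alpha y^\beta\in\mathbb K[x^*,y]$ is $\nu(f)=\min_{a_{\alpha,\beta}\ne0}(\omega\cdot\alpha+\eta\cdot\beta)$ (with $\nu(0)=\infty$); its initial part is the sum of the terms with $\omega\cdot\alpha+\eta\cdot\beta=\nu(f)$ if $\nu(f)<\infty$, and $0$ otherwise. $\mathrm{In}_{\omega,\eta}\mathcal I$ is the ideal generated by the initial parts of all $f\in\mathcal I$ and by the $y_i$ with $i\notin\Lambda(\eta)$. The pair $(\omega,\eta)$ is in the tropical variety of $\mathcal I$ if $\mathrm{In}_{\omega,\eta}\mathcal I\cap\mathbb K[x^*,y_{\Lambda(\eta)}]$ contains no monomial $cx^\alpha y^\beta$, $c\neq0$. **$\omega$-sequences.** An *$\omega$-set* is a triple $D=(\eta,\Gamma,c)$ with $\eta\in(\mathbb R\cup\{\infty\})^M$, $\Gamma\in\mathcal M_{M\times N}(\mathbb Q\cup\{\infty\})$,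 $c\in\mathbb K^M$, such that $\omega\cdot\Gamma^T=\eta$, the $i$-th row of $\Gamma$ is $(\infty,\dots,\infty)$ if $\eta_i=\infty$, and $c_i\ne0$ if and only if $\eta_i\neq\infty$. Let $\mathfrak M_D=(c_ix^{\Gamma_{i,*}})_{i}$ (an entry is $0$ when $c_i=0$), let $\mathfrak M_D(x^{rI})=(c_ix^{r\Gamma_{i,*}})_i$ for $r\in\mathbb Q$, and let $\mathbf d\Gamma\ge1$ be the least common multiple of the denominators of the finite entries of $\Gamma$. $D$ is a *starting $\omega$-set* for $\mathcal I$ if $(\omega,\eta)$ is in the tropical variety of $\mathcal I$ and $f(1,\dots,1,c)=0$ for all $f\in\mathrm{In}_{\omega,\eta}\mathcal I$. Let $$\mathcal I_D=\big\langle f(x_1^{\mathbf d\Gamma},\dots,x_N^{\mathbf d\Gamma},\,y+\mathfrak M_D(x^{\mathbf d\Gamma I})) : f\in\mathcal I\big\rangle\subset\mathbb K[x^*,y].$$ For $L\in\mathbb Z_{\ge0}\cup\{\infty\}$, a sequence $S=\{D^{(i)}\}_{0\le i\le L}$ (over all integers $i\ge0$ if $L=\infty$), $D^{(i)}=(\eta^{(i)},\Gamma^{(i)},c^{(i)})$,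 is an *$\omega$-sequence* for $\mathcal I$ if, with $\mathcal I^{(0)}=\mathcal I$ and $\mathcal I^{(i)}=(\mathcal I^{(i-1)})_{D^{(i-1)}}$, each $D^{(i)}$ is a starting $\omega$-set for $\mathcal I^{(i)}$, and for each $i\geq1$ and each $j\in\Lambda(\eta^{(i)})$ one has $\eta^{(i)}_j>\mathbf d\Gamma^{(i-1)}\,\eta^{(i-1)}_j$. The $M$-tuple of series *defined by* $S$ is the formal sum $$\mathbf{ser}(S)=\sum_{0\le i\le L}\mathfrak M_{D^{(i)}}(x^{r^{(i)}I}),\qquad r^{(i)}=\prod_{j=0}^{i-1}\frac1{\mathbf d\Gamma^{(j)}}.$$ **Statement.** Let $\mathcal I\subset\mathbb K[x^*,y]$ be an $N$-admissible ideal. 1. For every $\omega$-sequence $S$ for $\mathcal I$, finite or infinite, each exponent occurs in only finitely many terms of the sum $\mathbf{ser}(S)$ in each coordinate, and $\mathbf{ser}(S)\in\mathcal S_\omega^M$. 2. An $M$-tuple $\phi\in\mathcal S_\omega^M$ is an $\omega$-solution of $\mathcal I$ if and only if $\phi=\mathbf{ser}(S)$ for some infinite $\omega$-sequence $S=\{D^{(i)}\}_{i=0}^\infty$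 for $\mathcal I$. -/

import Mathlib

open MvPolynomial

noncomputable section

/-! ### Exponents ordered by a weight vector -/

/-- The weight `ω · α` of a rational exponent vector. -/
def omegaDot {N : ℕ} (ω : Fin N → ℝ) (α : Fin N → ℚ) : ℝ := ∑ l, ω l * (α l : ℝ)

/-- The additive group `ℚ ^ N` of exponents, ordered by means of `ω`. -/
def OmegaExp {N : ℕ} (_ω : Fin N → ℝ) : Type := Fin N → ℚ

/-- A rational vector, as an exponent. -/
def toExp {N : ℕ} (ω : Fin N → ℝ) (α : Fin N → ℚ) : OmegaExp ω := α

instance {N : ℕ} (ω : Fin N → ℝ) : AddCommGroup (OmegaExp ω) :=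
  inferInstanceAs (AddCommGroup (Fin N → ℚ))

lemma omegaDot_add {N : ℕ} (ω : Fin N → ℝ) (a b : OmegaExp ω) :
    omegaDot ω (a + b) = omegaDot ω a + omegaDot ω b := by
  simp only [omegaDot, ← Finset.sum_add_distrib]
  refine Finset.sum_congr rfl fun l _ => ?_
  have : (a + b) l = a l + b l := rfl
  rw [this]; push_cast; ring

/-- `α ≤ α'` if and only if `ω · α < ω · α'` or `α = α'`. When the coordinates of `ω` are rationally
independent, `α ↦ ω · α` is injective, and this is the total order
`α ≤ α' ↔ ω · α ≤ ω · α'`. -/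
instance {N : ℕ} (ω : Fin N → ℝ) : PartialOrder (OmegaExp ω) where
  le a b := a = b ∨ omegaDot ω a < omegaDot ω b
  le_refl a := Or.inl rfl
  le_trans a b c := by
    rintro (rfl | h) (rfl | h')
    · exact Or.inl rfl
    · exact Or.inr h'
    · exact Or.inr h
    · exact Or.inr (h.trans h')
  le_antisymm a b := by
    rintro (rfl | h) (h' | h')
    · rfl
    · rfl
    · exact h'.symm
    · exact absurd h' h.asymm

lemma OmegaExp.le_def {N : ℕ} {ω : Fin N → ℝ} {a b : OmegaExp ω} :
    a ≤ b ↔ a = b ∨ omegaDot ω a < omegaDot ω b := Iff.rfl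

instance {N : ℕ} (ω : Fin N → ℝ) : IsOrderedCancelAddMonoid (OmegaExp ω) where
  add_le_add_left a b h c := by
    rcases h with rfl | h
    · exact Or.inl rfl
    · refine Or.inr ?_
      rw [omegaDot_add, omegaDot_add]; linarith
  le_of_add_le_add_left a b c h := by
    rcases h with h | h
    · exact Or.inl (add_left_cancel h)
    · refine Or.inr ?_
      rw [omegaDot_add, omegaDot_add] at h; linarith

/-! ### The ring of `ω`-positive Puiseux series -/

/-- The real vector with the given rational coordinates. -/
def realVec {N : ℕ} (α : Fin N → ℚ) : Fin N → ℝ := fun l => (α l : ℝ)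

/-- Convex rational polyhedral cones: the cones generated by finitely many rational vectors. -/
def IsRationalCone {N : ℕ} (σ : PointedCone ℝ (Fin N → ℝ)) : Prop :=
  ∃ s : Finset (Fin N → ℚ), σ = PointedCone.hull ℝ (realVec '' (s : Set (Fin N → ℚ)))

/-- The cone `σ` is `ω`-positive. -/
def IsOmegaPositiveCone {N : ℕ} (ω : Fin N → ℝ) (σ : PointedCone ℝ (Fin N → ℝ)) : Prop :=
  ∀ v ∈ σ, 0 ≤ ∑ l, ω l * v l

/-- A set of exponents of an `ω`-positive Puiseux series: it lies in a lattice `(1/k) ℤ ^ N`, and a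
translate of it lies in an `ω`-positive rational cone. -/
def IsOmegaPuiseuxSupport {N : ℕ} (ω : Fin N → ℝ) (E : Set (Fin N → ℚ)) : Prop :=
  (∃ k : ℕ, 0 < k ∧ ∀ α ∈ E, ∀ l, ∃ z : ℤ, α l = (z : ℚ) / (k : ℚ)) ∧
  ∃ (γ : Fin N → ℚ) (σ : PointedCone ℝ (Fin N → ℝ)), IsRationalCone σ ∧
    IsOmegaPositiveCone ω σ ∧ ∀ α ∈ E, realVec (γ + α) ∈ σ

lemma realVec_add {N : ℕ} (a b : Fin N → ℚ) : realVec (a + b) = realVec a + realVec b := by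
  ext l; simp [realVec]

lemma IsOmegaPuiseuxSupport.mono {N : ℕ} {ω : Fin N → ℝ} {E F : Set (Fin N → ℚ)}
    (hF : IsOmegaPuiseuxSupport ω F) (h : E ⊆ F) : IsOmegaPuiseuxSupport ω E := by
  obtain ⟨⟨k, hk, h1⟩, γ, σ, hr, hp, h2⟩ := hF
  exact ⟨⟨k, hk, fun α hα => h1 α (h hα)⟩, γ, σ, hr, hp, fun α hα => h2 α (h hα)⟩

lemma isRationalCone_sup {N : ℕ} {σ τ : PointedCone ℝ (Fin N → ℝ)} (hσ : IsRationalCone σ)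
    (hτ : IsRationalCone τ) : IsRationalCone (σ ⊔ τ) := by
  classical
  obtain ⟨s, rfl⟩ := hσ
  obtain ⟨t, rfl⟩ := hτ
  refine ⟨s ∪ t, ?_⟩
  rw [Finset.coe_union, Set.image_union]
  exact (Submodule.span_union _ _).symm

lemma isOmegaPositiveCone_sup {N : ℕ} {ω : Fin N → ℝ} {σ τ : PointedCone ℝ (Fin N → ℝ)}
    (hσ : IsOmegaPositiveCone ω σ) (hτ : IsOmegaPositiveCone ω τ) :
    IsOmegaPositiveCone ω (σ ⊔ τ) := by
  intro v hv
  obtain ⟨a, ha, b, hb, rfl⟩ := Submodule.mem_sup.1 hv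
  have := hσ a ha
  have := hτ b hb
  simp only [Pi.add_apply, mul_add, Finset.sum_add_distrib]
  linarith

lemma isOmegaPositiveCone_hull_singleton {N : ℕ} {ω : Fin N → ℝ} {w : Fin N → ℝ}
    (hw : 0 ≤ ∑ l, ω l * w l) : IsOmegaPositiveCone ω (PointedCone.hull ℝ {w}) := by
  intro v hv
  obtain ⟨a, rfl⟩ := Submodule.mem_span_singleton.1 hv
  have : ∑ l, ω l * (a • w) l = (a : ℝ) * ∑ l, ω l * w l := by
    rw [Finset.mul_sum]
    refine Finset.sum_congr rfl fun l _ => ?_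
    change ω l * ((a : ℝ) * w l) = _
    ring
  rw [this]
  exact mul_nonneg a.2 hw

lemma isOmegaPuiseuxSupport_singleton {N : ℕ} (ω : Fin N → ℝ) (α : Fin N → ℚ) :
    IsOmegaPuiseuxSupport ω {α} := by
  refine ⟨⟨∏ l, (α l).den, Finset.prod_pos fun l _ => (α l).den_pos, ?_⟩, -α, ⊥, ?_, ?_, ?_⟩
  · intro β hβ l
    rw [Set.mem_singleton_iff.1 hβ]
    obtain ⟨m, hm⟩ := Finset.dvd_prod_of_mem (fun l => (α l).den) (Finset.mem_univ l)
    refine ⟨(α l).num * m, ?_⟩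
    have h0 : ∏ l, (α l).den ≠ 0 := Finset.prod_ne_zero_iff.2 fun l _ => (α l).den_nz
    have h2 : (m : ℚ) ≠ 0 := by
      intro h
      have h' : m = 0 := by exact_mod_cast h
      rw [hm, h', mul_zero] at h0
      exact h0 rfl
    rw [hm]
    push_cast
    rw [mul_div_mul_right _ _ h2]
    exact (Rat.num_div_den (α l)).symm
  · exact ⟨∅, by simp⟩
  · intro v hv
    rw [Submodule.mem_bot] at hv
    simp [hv]
  · intro β hβ
    rw [Set.mem_singleton_iff.1 hβ, Submodule.mem_bot]
    ext l; simp [realVec]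

lemma isOmegaPuiseuxSupport_union_aux {N : ℕ} {ω : Fin N → ℝ} {E F : Set (Fin N → ℚ)}
    {γ δ : Fin N → ℚ} {σ τ : PointedCone ℝ (Fin N → ℝ)} {k m : ℕ} (hk : 0 < k) (hm : 0 < m)
    (h1 : ∀ α ∈ E, ∀ l, ∃ z : ℤ, α l = (z : ℚ) / (k : ℚ))
    (h2 : ∀ α ∈ F, ∀ l, ∃ z : ℤ, α l = (z : ℚ) / (m : ℚ))
    (hσr : IsRationalCone σ) (hσp : IsOmegaPositiveCone ω σ) (hσ : ∀ α ∈ E, realVec (γ + α) ∈ σ)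
    (hτr : IsRationalCone τ) (hτp : IsOmegaPositiveCone ω τ) (hτ : ∀ α ∈ F, realVec (δ + α) ∈ τ)
    (hle : 0 ≤ ∑ l, ω l * realVec (γ - δ) l) : IsOmegaPuiseuxSupport ω (E ∪ F) := by
  have hk' : (k : ℚ) ≠ 0 := by exact_mod_cast hk.ne'
  have hm' : (m : ℚ) ≠ 0 := by exact_mod_cast hm.ne'
  refine ⟨⟨k * m, Nat.mul_pos hk hm, ?_⟩, γ,
    (σ ⊔ τ) ⊔ PointedCone.hull ℝ {realVec (γ - δ)}, ?_, ?_, ?_⟩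
  · rintro α (hα | hα) l
    · obtain ⟨z, hz⟩ := h1 α hα l
      refine ⟨z * m, ?_⟩
      rw [hz]; push_cast; field_simp
    · obtain ⟨z, hz⟩ := h2 α hα l
      refine ⟨z * k, ?_⟩
      rw [hz]; push_cast; field_simp
  · exact isRationalCone_sup (isRationalCone_sup hσr hτr) ⟨{γ - δ}, by simp⟩
  · exact isOmegaPositiveCone_sup (isOmegaPositiveCone_sup hσp hτp)
      (isOmegaPositiveCone_hull_singleton hle)
  · rintro α (hα | hα)
    · exact Submodule.mem_sup_left (Submodule.mem_sup_left (hσ α hα))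
    · have : γ + α = (δ + α) + (γ - δ) := by abel
      rw [this, realVec_add]
      exact add_mem (Submodule.mem_sup_left (Submodule.mem_sup_right (hτ α hα)))
        (Submodule.mem_sup_right (Submodule.subset_span rfl))

lemma IsOmegaPuiseuxSupport.union {N : ℕ} {ω : Fin N → ℝ} {E F : Set (Fin N → ℚ)}
    (hE : IsOmegaPuiseuxSupport ω E) (hF : IsOmegaPuiseuxSupport ω F) :
    IsOmegaPuiseuxSupport ω (E ∪ F) := by
  obtain ⟨⟨k, hk, h1⟩, γ, σ, hσr, hσp, hσ⟩ := hE
  obtain ⟨⟨m, hm, h2⟩, δ, τ, hτr, hτp, hτ⟩ := hF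
  rcases le_total 0 (∑ l, ω l * realVec (γ - δ) l) with h | h
  · exact isOmegaPuiseuxSupport_union_aux hk hm h1 h2 hσr hσp hσ hτr hτp hτ h
  · rw [Set.union_comm]
    refine isOmegaPuiseuxSupport_union_aux hm hk h2 h1 hτr hτp hτ hσr hσp hσ ?_
    have : ∑ l, ω l * realVec (δ - γ) l = - ∑ l, ω l * realVec (γ - δ) l := by
      rw [← Finset.sum_neg_distrib]
      refine Finset.sum_congr rfl fun l _ => ?_
      simp only [realVec, Pi.sub_apply]; push_cast; ring
    rw [this]; linarith

lemma IsOmegaPuiseuxSupport.add {N : ℕ} {ω : Fin N → ℝ} {E F G : Set (Fin N → ℚ)}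
    (hE : IsOmegaPuiseuxSupport ω E) (hF : IsOmegaPuiseuxSupport ω F)
    (hG : ∀ g ∈ G, ∃ a ∈ E, ∃ b ∈ F, a + b = g) : IsOmegaPuiseuxSupport ω G := by
  obtain ⟨⟨k, hk, h1⟩, γ, σ, hσr, hσp, hσ⟩ := hE
  obtain ⟨⟨m, hm, h2⟩, δ, τ, hτr, hτp, hτ⟩ := hF
  have hk' : (k : ℚ) ≠ 0 := by exact_mod_cast hk.ne'
  have hm' : (m : ℚ) ≠ 0 := by exact_mod_cast hm.ne'
  refine ⟨⟨k * m, Nat.mul_pos hk hm, ?_⟩, γ + δ, σ ⊔ τ, isRationalCone_sup hσr hτr,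
    isOmegaPositiveCone_sup hσp hτp, ?_⟩
  · intro g hg l
    obtain ⟨a, ha, b, hb, rfl⟩ := hG g hg
    obtain ⟨z, hz⟩ := h1 a ha l
    obtain ⟨y, hy⟩ := h2 b hb l
    refine ⟨z * m + y * k, ?_⟩
    rw [Pi.add_apply, hz, hy]; push_cast; field_simp
  · intro g hg
    obtain ⟨a, ha, b, hb, rfl⟩ := hG g hg
    have : γ + δ + (a + b) = (γ + a) + (δ + b) := by abel
    rw [this, realVec_add]
    exact add_mem (Submodule.mem_sup_left (hσ a ha)) (Submodule.mem_sup_right (hτ b hb))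

/-- When the coordinates of `ω` are rationally independent, every set of exponents of an `ω`-positive
Puiseux series is well-ordered. -/
theorem IsOmegaPuiseuxSupport.isPWO {N : ℕ} {ω : Fin N → ℝ} (hω : LinearIndependent ℚ ω)
    {E : Set (OmegaExp ω)} (hE : IsOmegaPuiseuxSupport ω E) : E.IsPWO := by
  classical
  have hinj : ∀ a : Fin N → ℚ, omegaDot ω a = 0 → a = 0 := by
    intro a ha
    funext l
    refine Fintype.linearIndependent_iff.1 hω a ?_ l
    rw [← ha]
    exact Finset.sum_congr rfl fun i _ => by rw [Rat.smul_def, mul_comm]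
  obtain ⟨⟨k, hk, h1⟩, γ, σ, ⟨s, rfl⟩, hp, h2⟩ := hE
  have hkr : (0 : ℝ) < k := by exact_mod_cast hk
  obtain ⟨C, hC⟩ : ∃ C : ℝ, ∀ v ∈ PointedCone.hull ℝ (realVec '' (s : Set (Fin N → ℚ))), ∀ l,
      |v l| ≤ C * ∑ i, ω i * v i := by
    have hpos : ∀ w ∈ s, 0 ≤ omegaDot ω w := fun w hw =>
      hp _ (Submodule.subset_span ⟨w, hw, rfl⟩)
    refine ⟨∑ w ∈ s, ∑ l, |(w l : ℝ)| / omegaDot ω w, fun v hv l => ?_⟩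
    induction hv using Submodule.span_induction with
    | mem v hv =>
      obtain ⟨w, hw, rfl⟩ := hv
      change |(w l : ℝ)| ≤ _ * omegaDot ω w
      rcases (hpos w hw).eq_or_lt with h | h
      · have := hinj w h.symm
        subst this
        simp [omegaDot]
      · have hle : |(w l : ℝ)| / omegaDot ω w ≤ ∑ w ∈ s, ∑ l, |(w l : ℝ)| / omegaDot ω w := by
          refine le_trans ?_ (Finset.single_le_sum (f := fun w => ∑ l, |(w l : ℝ)| / omegaDot ω w)
            (fun u hu => Finset.sum_nonneg fun i _ => div_nonneg (abs_nonneg _) (hpos u hu)) hw)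
          exact Finset.single_le_sum (f := fun l => |(w l : ℝ)| / omegaDot ω w)
            (fun i _ => div_nonneg (abs_nonneg _) (hpos w hw)) (Finset.mem_univ l)
        exact (div_le_iff₀ h).1 hle
    | zero => simp
    | add u v _ _ hu hv =>
      simp only [Pi.add_apply, mul_add, Finset.sum_add_distrib]
      exact (abs_add_le _ _).trans (by simpa [mul_add] using add_le_add hu hv)
    | smul a v _ hv =>
      have e : ∑ i, ω i * (a • v) i = (a : ℝ) * ∑ i, ω i * v i := by
        rw [Finset.mul_sum]
        refine Finset.sum_congr rfl fun i _ => ?_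
        change ω i * ((a : ℝ) * v i) = _
        ring
      have e' : (a • v) l = (a : ℝ) * v l := rfl
      have ha : (0 : ℝ) ≤ a := a.2
      rw [e, e', abs_mul, abs_of_nonneg ha]
      nlinarith [mul_le_mul_of_nonneg_left hv ha]
  have hC0 : ∀ t : ℝ, {a ∈ E | omegaDot ω a ≤ t}.Finite := by
    intro t
    obtain ⟨B, hB⟩ : ∃ B : ℕ, ∀ a ∈ E, omegaDot ω a ≤ t → ∀ l, |(a l : ℝ)| * k ≤ B := by
      obtain ⟨B, hB⟩ := exists_nat_ge
        ((|C| * (omegaDot ω γ + t) + ∑ i, |(γ i : ℝ)|) * k)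
      refine ⟨B, fun a ha hat l => le_trans (mul_le_mul_of_nonneg_right ?_ hkr.le) hB⟩
      have h2' := h2 a ha
      change realVec (toExp ω γ + a) ∈ _ at h2'
      have h := hC _ h2' l
      have h0 := hp _ h2'
      have e : ∑ i, ω i * realVec (toExp ω γ + a) i = omegaDot ω γ + omegaDot ω a :=
        omegaDot_add ω γ a
      rw [e] at h h0
      have e2 : realVec (toExp ω γ + a) l = (γ l : ℝ) + (a l : ℝ) := by
        change (((γ l + a l : ℚ)) : ℝ) = _
        push_cast; rfl
      rw [e2] at h
      have h3 : |(γ l : ℝ)| ≤ ∑ i, |(γ i : ℝ)| :=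
        Finset.single_le_sum (f := fun i => |(γ i : ℝ)|) (fun i _ => abs_nonneg _)
          (Finset.mem_univ l)
      have h4 : |(a l : ℝ)| ≤ |(γ l : ℝ) + (a l : ℝ)| + |(γ l : ℝ)| := by
        have := abs_sub ((γ l : ℝ) + (a l : ℝ)) (γ l : ℝ)
        simpa using this
      have h5 : C * (omegaDot ω γ + omegaDot ω a) ≤ |C| * (omegaDot ω γ + t) :=
        (mul_le_mul_of_nonneg_right (le_abs_self C) h0).trans
          (mul_le_mul_of_nonneg_left (by linarith) (abs_nonneg C))
      linarith
    refine ((Set.Finite.pi' (fun _ : Fin N => Set.finite_Icc (-(B : ℤ)) B)).image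
      (fun z l => (z l : ℚ) / (k : ℚ))).subset ?_
    rintro a ⟨ha, hat⟩
    choose z hz using h1 a ha
    refine ⟨z, fun l => ?_, funext fun l => (hz l).symm⟩
    have h := hB a ha hat l
    rw [hz l] at h
    push_cast at h
    rw [abs_div, abs_of_pos hkr, div_mul_cancel₀ _ hkr.ne'] at h
    have h' : |z l| ≤ (B : ℤ) := by exact_mod_cast h
    exact abs_le.1 h'
  intro g
  set f : ℕ → OmegaExp ω := fun n => (g n).1 with hfdef
  have hf : ∀ n, f n ∈ E := fun n => (g n).2
  by_contra hcon
  push Not at hcon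
  have hlt : ∀ m n : ℕ, m < n → f m ≠ f n ∧ omegaDot ω (f n) ≤ omegaDot ω (f m) := by
    intro m n hmn
    have h : ¬ f m ≤ f n := hcon m n hmn
    exact ⟨fun h' => h (Or.inl h'), not_lt.1 fun h' => h (Or.inr h')⟩
  have hfinj : Function.Injective f := by
    intro m n hmn
    rcases lt_trichotomy m n with h | h | h
    · exact absurd hmn (hlt m n h).1
    · exact h
    · exact absurd hmn.symm (hlt n m h).1
  refine Set.infinite_of_injective_forall_mem hfinj (fun n => ?_) (hC0 (omegaDot ω (f 0)))
  refine ⟨hf n, ?_⟩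
  rcases Nat.eq_zero_or_pos n with rfl | h
  · exact le_rfl
  · exact (hlt 0 n h).2

/-- The ring `S_ω` of `ω`-positive Puiseux series with coefficients in `K`: the fractional power
series `∑ c_α x ^ α` whose set of exponents lies in a lattice and has a translate inside an
`ω`-positive rational cone. It is realised inside the Hahn series with exponents ordered by `ω`;
by `IsOmegaPuiseuxSupport.isPWO` this ambient ring imposes no further restriction. -/
def OmegaPuiseux {N : ℕ} (K : Type*) [Field K] (ω : Fin N → ℝ) :
    Subalgebra K (HahnSeries (OmegaExp ω) K) where
  carrier := {f | IsOmegaPuiseuxSupport ω {α | f.coeff (toExp ω α) ≠ 0}}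
  mul_mem' {f g} hf hg := by
    refine IsOmegaPuiseuxSupport.add hf hg fun α hα => ?_
    obtain ⟨a, ha, b, hb, hab⟩ := HahnSeries.support_mul_subset
      ((HahnSeries.mem_support (f * g) (toExp ω α)).2 hα)
    exact ⟨a, ha, b, hb, hab⟩
  add_mem' {f g} hf hg :=
    (IsOmegaPuiseuxSupport.union hf hg).mono fun α hα =>
      HahnSeries.support_add_subset f g ((HahnSeries.mem_support (f + g) (toExp ω α)).2 hα)
  algebraMap_mem' r := by
    refine (isOmegaPuiseuxSupport_singleton ω 0).mono fun α hα => ?_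
    exact HahnSeries.support_single_subset (a := (0 : OmegaExp ω)) (r := r)
      ((HahnSeries.mem_support _ (toExp ω α)).2 hα)

/-- The monomial `c x ^ α`, as an `ω`-positive Puiseux series. -/
def puiseuxMonomial {N : ℕ} {K : Type*} [Field K] (ω : Fin N → ℝ) (α : Fin N → ℚ) (c : K) :
    OmegaPuiseux K ω :=
  ⟨HahnSeries.single (toExp ω α) c, (isOmegaPuiseuxSupport_singleton ω α).mono fun β hβ =>
    HahnSeries.support_single_subset (a := toExp ω α) (r := c)
      ((HahnSeries.mem_support _ (toExp ω β)).2 hβ)⟩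

lemma puiseuxMonomial_mul {N : ℕ} {K : Type*} [Field K] (ω : Fin N → ℝ) (α β : Fin N → ℚ)
    (a b : K) : puiseuxMonomial ω α a * puiseuxMonomial ω β b = puiseuxMonomial ω (α + β) (a * b) :=
  Subtype.ext HahnSeries.single_mul_single

/-! ### The polynomial rings and `N`-admissible ideals -/

/-- The ring `K[x^*] = K[x₁, x₁⁻¹, …, x_N, x_N⁻¹]` of Laurent polynomials. -/
abbrev LaurentRing (N : ℕ) (K : Type*) [Field K] : Type _ := AddMonoidAlgebra K (Fin N → ℤ)

/-- The ring `K[x^*, y] = K[x^*][y₁, …, y_M]`. -/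
abbrev MixedRing (N M : ℕ) (K : Type*) [Field K] : Type _ := MvPolynomial (Fin M) (LaurentRing N K)

/-- The monomial `c x ^ α y ^ β` of `K[x^*, y]`. -/
def mixedMonomial {N M : ℕ} {K : Type*} [Field K] (α : Fin N → ℤ) (β : Fin M →₀ ℕ) (c : K) :
    MixedRing N M K :=
  MvPolynomial.monomial β (AddMonoidAlgebra.single α c)

/-- The inclusion of `K[x, y]` in `K[x^*, y]`. -/
def polyInclusion (N M : ℕ) (K : Type*) [Field K] :
    MvPolynomial (Fin N ⊕ Fin M) K →ₐ[K] MixedRing N M K :=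
  MvPolynomial.aeval
    (Sum.elim (fun l => mixedMonomial (Pi.single l 1) 0 1) (fun j => MvPolynomial.X j))

/-- An ideal `J` of `K[x, y]` is `N`-admissible when the projection of its zero set `V(J)` to the
`x`-coordinates is dominant (no nonzero polynomial vanishes on the image) and has finite generic
fibre (all the fibres over some nonempty principal open set are finite). -/
def IsAdmissible {N M : ℕ} {K : Type*} [Field K]
    (J : Ideal (MvPolynomial (Fin N ⊕ Fin M) K)) : Prop :=
  (∀ g : MvPolynomial (Fin N) K,
    (∀ p ∈ zeroLocus K J, MvPolynomial.eval (p ∘ Sum.inl) g = 0) → g = 0) ∧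
  ∃ g : MvPolynomial (Fin N) K, g ≠ 0 ∧ ∀ a : Fin N → K, MvPolynomial.eval a g ≠ 0 →
    {p ∈ zeroLocus K J | p ∘ Sum.inl = a}.Finite

/-- An ideal `I` of `K[x^*, y]` is `N`-admissible when `I ∩ K[x, y]` is. -/
def IsLaurentAdmissible {N M : ℕ} {K : Type*} [Field K] (I : Ideal (MixedRing N M K)) : Prop :=
  IsAdmissible (I.comap (polyInclusion N M K))

/-- The inclusion of `K[x^*]` in `S_ω`. -/
def laurentToPuiseux {N : ℕ} (K : Type*) [Field K] (ω : Fin N → ℝ) :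
    LaurentRing N K →ₐ[K] OmegaPuiseux K ω :=
  AddMonoidAlgebra.lift K (OmegaPuiseux K ω) (Fin N → ℤ)
    { toFun := fun α => puiseuxMonomial ω (fun l => (α.toAdd l : ℚ)) 1
      map_one' := by
        have h : (fun l => ((Multiplicative.toAdd (1 : Multiplicative (Fin N → ℤ)) l : ℤ) : ℚ))
            = (0 : Fin N → ℚ) := by
          funext l; simp
        rw [h]; rfl
      map_mul' := fun α β => by
        rw [puiseuxMonomial_mul, one_mul]
        congr 1
        funext l
        simp }

/-- `φ ∈ S_ω ^ M` is an `ω`-solution of `I` when `f(x, φ(x)) = 0` for all `f ∈ I`. -/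
def IsOmegaSolution {N M : ℕ} {K : Type*} [Field K] (ω : Fin N → ℝ) (I : Ideal (MixedRing N M K))
    (φ : Fin M → OmegaPuiseux K ω) : Prop :=
  ∀ f ∈ I, MvPolynomial.eval₂ (laurentToPuiseux K ω : LaurentRing N K →+* OmegaPuiseux K ω) φ f = 0

/-! ### Initial ideals and the tropical variety

In `WithTop ℝ` multiplication satisfies `⊤ * a = ⊤` for every `a ≠ 0` and `⊤ * 0 = 0`. -/

/-- The weight `ω · α + η · β` of the monomial `x ^ α y ^ β`. -/
def mixedWeight {N M : ℕ} (ω : Fin N → ℝ) (η : Fin M → WithTop ℝ) (α : Fin N → ℤ)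
    (β : Fin M →₀ ℕ) : WithTop ℝ :=
  ((∑ l, ω l * (α l : ℝ) : ℝ) : WithTop ℝ) + ∑ j, η j * (((β j : ℕ) : ℝ) : WithTop ℝ)

/-- The `(ω, η)`-order of a polynomial: the least weight of its monomials (`⊤` for `f = 0`). -/
def mixedOrder {N M : ℕ} {K : Type*} [Field K] (ω : Fin N → ℝ) (η : Fin M → WithTop ℝ)
    (f : MixedRing N M K) : WithTop ℝ :=
  f.support.inf fun β => (MvPolynomial.coeff β f).coeff.support.inf fun α => mixedWeight ω η α β

open Classical in
/-- The `(ω, η)`-initial part of a polynomial: the sum of its terms of least weight, and `0` if the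
order is `⊤`. -/
def initialPart {N M : ℕ} {K : Type*} [Field K] (ω : Fin N → ℝ) (η : Fin M → WithTop ℝ)
    (f : MixedRing N M K) : MixedRing N M K :=
  if mixedOrder ω η f = ⊤ then 0 else
    ∑ β ∈ f.support, ∑ α ∈ (MvPolynomial.coeff β f).coeff.support,
      if mixedWeight ω η α β = mixedOrder ω η f then
        mixedMonomial α β ((MvPolynomial.coeff β f).coeff α)
      else 0

/-- The `(ω, η)`-initial ideal, generated by the initial parts of the elements of `I` and by the
variables `y_j` with `η_j = ∞`. -/
def initialIdeal {N M : ℕ} {K : Type*} [Field K] (ω : Fin N → ℝ) (η : Fin M → WithTop ℝ)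
    (I : Ideal (MixedRing N M K)) : Ideal (MixedRing N M K) :=
  Ideal.span ({g | ∃ f ∈ I, g = initialPart ω η f} ∪ {g | ∃ j, η j = ⊤ ∧ g = MvPolynomial.X j})

/-- The tropical variety of `I`: the set of all `(ω, η)` such that the initial ideal contains no
monomial `c x ^ α y ^ β`, `c ≠ 0`, in the variables `x` and the `y_j` with `η_j ≠ ∞`. -/
def tropicalVariety {N M : ℕ} {K : Type*} [Field K] (I : Ideal (MixedRing N M K)) :
    Set ((Fin N → ℝ) × (Fin M → WithTop ℝ)) :=
  {p | ∀ (α : Fin N → ℤ) (β : Fin M →₀ ℕ) (c : K), c ≠ 0 → (∀ j, p.2 j = ⊤ → β j = 0) →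
    mixedMonomial α β c ∉ initialIdeal p.1 p.2 I}

/-! ### `ω`-sets -/

/-- Triples `(η, Γ, c)`. -/
structure OmegaData (N M : ℕ) (K : Type*) where
  /-- the orders -/
  η : Fin M → WithTop ℝ
  /-- the matrix of exponents -/
  Γ : Matrix (Fin M) (Fin N) (WithTop ℚ)
  /-- the coefficients -/
  c : Fin M → K

/-- The triple is an `ω`-set: `ω · Γᵀ = η`, the rows of `Γ` with `η_i = ∞` are `(∞, …, ∞)`, and
`c_i` is nonzero exactly when `η_i ≠ ∞`. -/
def IsOmegaSet {N M : ℕ} {K : Type*} [Field K] (ω : Fin N → ℝ) (D : OmegaData N M K) : Prop :=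
  (∀ i, ∑ l, (ω l : WithTop ℝ) * (D.Γ i l).map (fun q : ℚ => (q : ℝ)) = D.η i) ∧
  (∀ i, D.η i = ⊤ → ∀ l, D.Γ i l = ⊤) ∧
  (∀ i, D.c i ≠ 0 ↔ D.η i ≠ ⊤)

/-- The `M`-tuple of monomials `𝔐_D(x ^ {r I}) = (c_i x ^ {r Γ_i})_i`. The entries `∞` of `Γ`
occur, for an `ω`-set, only where `c_i = 0`, and the monomial is then `0`. -/
def OmegaData.monomials {N M : ℕ} {K : Type*} [Field K] (ω : Fin N → ℝ) (D : OmegaData N M K)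
    (r : ℚ) (i : Fin M) : OmegaPuiseux K ω :=
  puiseuxMonomial ω (fun l => r * (D.Γ i l).untopD 0) (D.c i)

/-- The least common multiple of the denominators of the finite entries of `Γ`. -/
def OmegaData.d {N M : ℕ} {K : Type*} (D : OmegaData N M K) : ℕ :=
  Finset.univ.lcm fun p : Fin M × Fin N => ((D.Γ p.1 p.2).untopD 0).den

/-- The ring homomorphism `K[x^*] → K`, `x ↦ (1, …, 1)`. -/
def evalOne (N : ℕ) (K : Type*) [Field K] : LaurentRing N K →ₐ[K] K :=
  AddMonoidAlgebra.lift K K (Fin N → ℤ) 1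

/-- `D` is a starting `ω`-set for `I`. -/
def IsStartingOmegaSet {N M : ℕ} {K : Type*} [Field K] (ω : Fin N → ℝ)
    (I : Ideal (MixedRing N M K)) (D : OmegaData N M K) : Prop :=
  IsOmegaSet ω D ∧ (ω, D.η) ∈ tropicalVariety I ∧
  ∀ f ∈ initialIdeal ω D.η I, MvPolynomial.eval₂ (evalOne N K : LaurentRing N K →+* K) D.c f = 0

/-! ### The ideals `I_D`, `ω`-sequences and the series they define -/

/-- The ring homomorphism `K[x^*] → K[x^*]`, `x ↦ x ^ {d I} = (x₁ ^ d, …, x_N ^ d)`. -/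
def ramify (N : ℕ) (K : Type*) [Field K] (d : ℕ) : LaurentRing N K →+* LaurentRing N K :=
  AddMonoidAlgebra.mapDomainRingHom K (d • AddMonoidHom.id (Fin N → ℤ))

/-- The substitution `f ↦ f(x ^ {d I}, y + 𝔐_D(x ^ {d I}))` of `K[x^*, y]`, with `d` the common
denominator of `Γ`. The exponents `d Γ_{i,l}` are integers, so they equal their numerators. -/
def OmegaData.subst {N M : ℕ} {K : Type*} [Field K] (D : OmegaData N M K) :
    MixedRing N M K →+* MixedRing N M K :=
  MvPolynomial.eval₂Hom (MvPolynomial.C.comp (ramify N K D.d)) fun i =>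
    MvPolynomial.X i + mixedMonomial (fun l => ((D.d : ℚ) * (D.Γ i l).untopD 0).num) 0 (D.c i)

/-- The ideal `I_D` generated by the `f(x ^ {d I}, y + 𝔐_D(x ^ {d I}))`, `f ∈ I`. -/
def idealStep {N M : ℕ} {K : Type*} [Field K] (I : Ideal (MixedRing N M K))
    (D : OmegaData N M K) : Ideal (MixedRing N M K) :=
  Ideal.span {g | ∃ f ∈ I, g = D.subst f}

/-- The ideals `I⁽⁰⁾ = I`, `I⁽ⁱ⁺¹⁾ = (I⁽ⁱ⁾)_{D⁽ⁱ⁾}`. -/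
def idealSeq {N M : ℕ} {K : Type*} [Field K] (I : Ideal (MixedRing N M K))
    (S : ℕ → OmegaData N M K) : ℕ → Ideal (MixedRing N M K)
  | 0 => I
  | i + 1 => idealStep (idealSeq I S i) (S i)

/-- `{D⁽ⁱ⁾}` for `0 ≤ i ≤ L`, where `L` is a natural number or `∞`, is an `ω`-sequence for `I`.
Only the terms `S i` with `i ≤ L` matter. -/
def IsOmegaSequence {N M : ℕ} {K : Type*} [Field K] (ω : Fin N → ℝ)
    (I : Ideal (MixedRing N M K)) (L : ℕ∞) (S : ℕ → OmegaData N M K) : Prop :=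
  (∀ i : ℕ, (i : ℕ∞) ≤ L → IsStartingOmegaSet ω (idealSeq I S i) (S i)) ∧
  ∀ i : ℕ, ((i + 1 : ℕ) : ℕ∞) ≤ L → ∀ j, (S (i + 1)).η j ≠ ⊤ →
    (((S i).d : ℝ) : WithTop ℝ) * (S i).η j < (S (i + 1)).η j

/-- `r⁽ⁱ⁾ = 1 / ∏_{j < i} d Γ⁽ʲ⁾`. -/
def ramIndex {N M : ℕ} {K : Type*} (S : ℕ → OmegaData N M K) (i : ℕ) : ℚ :=
  1 / ∏ j ∈ Finset.range i, ((S j).d : ℚ)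

/-- The set of the indices `i ≤ L` whose monomial `𝔐_{D⁽ⁱ⁾}(x ^ {r⁽ⁱ⁾ I})` contributes to the
coefficient of `x ^ γ` in the `j`-th coordinate of the series defined by the sequence. -/
def contributors {N M : ℕ} {K : Type*} [Field K] (ω : Fin N → ℝ) (L : ℕ∞)
    (S : ℕ → OmegaData N M K) (j : Fin M) (γ : OmegaExp ω) : Set ℕ :=
  {i | (i : ℕ∞) ≤ L ∧ ((S i).monomials ω (ramIndex S i) j).1.coeff γ ≠ 0}

/-- The coefficient of `x ^ γ` in the `j`-th coordinate of the formal sum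
`∑_{0 ≤ i ≤ L} 𝔐_{D⁽ⁱ⁾}(x ^ {r⁽ⁱ⁾ I})` (meaningful when finitely many terms contribute). -/
def serCoeff {N M : ℕ} {K : Type*} [Field K] (ω : Fin N → ℝ) (L : ℕ∞)
    (S : ℕ → OmegaData N M K) (j : Fin M) (γ : OmegaExp ω) : K :=
  ∑ᶠ i ∈ contributors ω L S j γ, ((S i).monomials ω (ramIndex S i) j).1.coeff γ

/-- `φ` is the `M`-tuple of series defined by the sequence: the formal sum
`∑_{0 ≤ i ≤ L} 𝔐_{D⁽ⁱ⁾}(x ^ {r⁽ⁱ⁾ I})` makes sense coefficientwise, and it is equal to `φ`. -/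
def IsSeriesOf {N M : ℕ} {K : Type*} [Field K] (ω : Fin N → ℝ) (L : ℕ∞)
    (S : ℕ → OmegaData N M K) (φ : Fin M → OmegaPuiseux K ω) : Prop :=
  ∀ j γ, (contributors ω L S j γ).Finite ∧ (φ j).1.coeff γ = serCoeff ω L S j γ

end

/-! Expanding the substitutions along an `ω`-sequence shows that the polynomial obtained from `f` at
stage `i` is, after rescaling exponents, `f(x, y + p_i)`, where `p_i` is the `i`-th partial sum. The
starting condition then means that replacing `y` by the next monomials cancels the part of least
weight (`CancelsInitial`). This cancellation is equivalent to being a starting `ω`-set: once the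
initial ideal vanishes at `(1, …, 1, c)`, it contains no monomial in `x` and the `y_j` with `c_j ≠
0`.

Summability is easy, because the exponents in each coordinate have strictly increasing weights. The
support condition is the substantial point when infinitely many terms are nonzero. Chevalley's
theorem and the finite generic fibre give a nonzero `G(x, y_j)` in the ideal, which reduces the
question to the Newton–Puiseux process in one variable (`exists_exponents_mem_closure`). There the
root multiplicities decrease to a stable value `μ`. From then on the initial forms are `a (y - c_i)
^ μ`, and in characteristic zero the coefficient of `y ^ (μ - 1)` is nonzero. Each new exponent
therefore occurs in a fixed Hasse derivative of `G` evaluated at the previous partial sum. This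
recursion confines all later exponents to a translate of one finitely generated monoid of
nonnegative weights.

An infinite sequence gives a solution because the weights of its terms tend to infinity: a least
exponent of a nonzero `f(x, φ)` would already occur in `f(x, p_i)` for large `i`, contradicting
cancellation. Conversely, stripping the terms of a solution in order of weight gives its sequence
(`solutionSeq`). Each tail solves the corresponding transformed ideal, so its leading terms cancel
initial parts. -/

noncomputable section

/-! ### Elimination: a polynomial in `x` and a single `y_j`. -/

/-- A ring homomorphism of finite presentation from a domain that is injective hits every prime of
some nonempty principal open set. -/
lemma exists_ne_zero_forall_mem_range_comap {B S : Type*} [CommRing B] [IsDomain B]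
    [CommRing S] (f : B →+* S) (hf : f.FinitePresentation) (hinj : Function.Injective f) :
    ∃ h : B, h ≠ 0 ∧ ∀ p : PrimeSpectrum B, h ∉ p.asIdeal →
      p ∈ Set.range (PrimeSpectrum.comap f) := by
  obtain ⟨T, hT⟩ := PrimeSpectrum.exists_constructibleSetData_iff.2
    (PrimeSpectrum.isConstructible_range_comap hf)
  -- The generic point is in the image because minimal primes lift along injective homomorphisms.
  have hbot : (⟨⊥, Ideal.isPrime_bot⟩ : PrimeSpectrum B) ∈
      Set.range (PrimeSpectrum.comap f) := by
    obtain ⟨q, hq, hqe⟩ := Ideal.exists_comap_eq_of_mem_minimalPrimes_of_injective hinj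
      (⊥ : Ideal B) (by rw [IsDomain.minimalPrimes_eq_singleton_bot]; rfl)
    exact ⟨⟨q, hq⟩, PrimeSpectrum.ext hqe⟩
  rw [← hT] at hbot ⊢
  simp only [PrimeSpectrum.ConstructibleSetData.toSet, Set.mem_iUnion] at hbot
  obtain ⟨C, hC, h1, h2⟩ := hbot
  -- The locally closed piece `V(C.g) \ V(C.f)` containing the generic point has all `C.g i = 0` and
  -- `C.f ≠ 0`, so it is a nonempty principal open set.
  refine ⟨C.f, fun h => h2 (by simp [h]), fun p hp => ?_⟩
  simp only [PrimeSpectrum.ConstructibleSetData.toSet, Set.mem_iUnion]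
  refine ⟨C, hC, ?_, fun h => hp (by simpa using h)⟩
  rintro _ ⟨i, rfl⟩
  have : C.g i = 0 := by simpa using h1 ⟨i, rfl⟩
  rw [this]
  exact zero_mem _

/-- The inclusion of `K[x][t]` in `K[x, y]` with `t ↦ y_j`. -/
def singleVarInclusion {N M : ℕ} (K : Type*) [Field K] (j : Fin M) :
    Polynomial (MvPolynomial (Fin N) K) →+* MvPolynomial (Fin N ⊕ Fin M) K :=
  Polynomial.eval₂RingHom (rename Sum.inl : _ →ₐ[K] _).toRingHom (X (Sum.inr j))

/-- The generic points of the `(x, y_j)`-space lift to the zero set of an ideal containing no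
nonzero polynomial in these variables. -/
lemma exists_forall_exists_mem_zeroLocus {K : Type*} [Field K] [IsAlgClosed K] {N M : ℕ}
    {J : Ideal (MvPolynomial (Fin N ⊕ Fin M) K)} (j : Fin M)
    (hJ : ∀ q, singleVarInclusion K j q ∈ J → q = 0) :
    ∃ h : Polynomial (MvPolynomial (Fin N) K), h ≠ 0 ∧ ∀ (a : Fin N → K) (b : K),
      h.eval₂ (eval a) b ≠ 0 → ∃ p ∈ zeroLocus K J, p ∘ Sum.inl = a ∧ p (Sum.inr j) = b := by
  set f := (Ideal.Quotient.mk J).comp (singleVarInclusion K j) with hfdef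
  have hinj : Function.Injective f := by
    rw [injective_iff_map_eq_zero]
    exact fun q hq => hJ q (Ideal.Quotient.eq_zero_iff_mem.1 hq)
  -- The quotient is of finite type over `K`, hence over `K[x][t]`. Finite presentation follows
  -- because `K[x][t]` is Noetherian.
  have hfin : f.FiniteType := by
    refine RingHom.FiniteType.of_comp_finiteType (f := Polynomial.C.comp MvPolynomial.C) ?_
    have : f.comp (Polynomial.C.comp MvPolynomial.C) = (Ideal.Quotient.mk J).comp MvPolynomial.C := by
      ext r
      simp [hfdef, singleVarInclusion]
    rw [this]
    refine RingHom.FiniteType.comp_surjective (f := MvPolynomial.C) ?_ Ideal.Quotient.mk_surjective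
    exact RingHom.finiteType_algebraMap.2
      (inferInstance : Algebra.FiniteType K (MvPolynomial (Fin N ⊕ Fin M) K))
  obtain ⟨h, h0, hh⟩ := exists_ne_zero_forall_mem_range_comap f
    (RingHom.FinitePresentation.of_finiteType.1 hfin) hinj
  refine ⟨h, h0, fun a b hab => ?_⟩
  set ev := Polynomial.eval₂RingHom (eval a) b with hev
  have hsurj : Function.Surjective ev := fun c => ⟨Polynomial.C (MvPolynomial.C c), by simp [hev]⟩
  have hmax : (RingHom.ker ev).IsMaximal := RingHom.ker_isMaximal_of_surjective ev hsurj
  obtain ⟨Q, hQ⟩ := hh ⟨RingHom.ker ev, hmax.isPrime⟩ (by simpa [hev] using hab)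
  -- The prime `Q` over the point `(a, b)` need not be maximal. A maximal ideal above it is a point
  -- of the zero set by the Nullstellensatz, and it still lies over `(a, b)` because the ideal of
  -- that point is maximal.
  obtain ⟨m, hm, hQm⟩ := Ideal.exists_le_maximal (Q.asIdeal.comap (Ideal.Quotient.mk J))
    (Ideal.IsPrime.ne_top inferInstance)
  obtain ⟨p, rfl⟩ := isMaximal_iff_eq_vanishingIdeal_singleton.1 hm
  have key : ∀ q, ev q = 0 → aeval p (singleVarInclusion K j q) = 0 := by
    intro q hq
    have : q ∈ (PrimeSpectrum.comap f Q).asIdeal := by rw [hQ]; exact hq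
    exact (mem_vanishingIdeal_singleton_iff p _).1 (hQm this)
  refine ⟨p, fun q hq => (mem_vanishingIdeal_singleton_iff p _).1 (hQm ?_), ?_, ?_⟩
  · rw [Ideal.mem_comap, Ideal.Quotient.eq_zero_iff_mem.2 hq]
    exact zero_mem _
  · funext l
    have := key (Polynomial.C (X l - C (a l))) (by simp [hev])
    simpa [singleVarInclusion, sub_eq_zero] using this
  · have := key (Polynomial.X - Polynomial.C (C b)) (by simp [hev])
    simpa [singleVarInclusion, sub_eq_zero] using this

/-- Otherwise the image of the zero set in `(x, y_j)`-space contains a nonempty principal open set,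
and over a general `a` the coordinate `y_j` takes all but finitely many values. This contradicts the
finiteness of the fibre. -/
lemma IsAdmissible.exists_singleVarInclusion_mem {K : Type*} [Field K] [IsAlgClosed K] {N M : ℕ}
    {J : Ideal (MvPolynomial (Fin N ⊕ Fin M) K)} (hJ : IsAdmissible J) (j : Fin M) :
    ∃ q, q ≠ 0 ∧ singleVarInclusion K j q ∈ J := by
  by_contra! hcon
  obtain ⟨h, h0, hh⟩ := exists_forall_exists_mem_zeroLocus (J := J) j
    fun q hq => by_contra fun hq0 => hcon q hq0 hq
  obtain ⟨g, g0, hg⟩ := hJ.2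
  have : Infinite K := IsAlgClosed.instInfinite
  -- The factor `g` makes the fibre over `a` finite; the leading coefficient keeps `h` nonzero after
  -- specialising `x` to `a`.
  obtain ⟨a, ha⟩ : ∃ a, eval a (g * h.leadingCoeff) ≠ 0 := by
    by_contra! hz
    exact mul_ne_zero g0 (Polynomial.leadingCoeff_ne_zero.2 h0)
      (MvPolynomial.funext fun a => by rw [hz a, map_zero])
  rw [map_mul] at ha
  have hmap : h.map (eval a) ≠ 0 := fun hz =>
    right_ne_zero_of_mul ha (by
      rw [Polynomial.leadingCoeff, ← Polynomial.coeff_map, hz, Polynomial.coeff_zero])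
  have hinf : ((h.map (eval a)).rootSet K)ᶜ.Infinite :=
    (Polynomial.rootSet_finite _ K).infinite_compl
  refine hinf (((hg a (left_ne_zero_of_mul ha)).image (fun p => p (Sum.inr j))).subset ?_)
  intro b hb
  obtain ⟨p, hp, hpa, hpb⟩ := hh a b fun hz => hb (by
    rw [Polynomial.mem_rootSet]
    exact ⟨hmap, by simpa [Polynomial.aeval_def, Polynomial.eval₂_map] using hz⟩)
  exact ⟨p, ⟨hp, hpa⟩, hpb⟩

/-- An admissible ideal contains, for each `j`, a nonzero polynomial in `x` and `y_j`. -/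
lemma IsLaurentAdmissible.exists_aeval_mem {K : Type*} [Field K] [IsAlgClosed K] {N M : ℕ}
    {I : Ideal (MixedRing N M K)} (hI : IsLaurentAdmissible I) (j : Fin M) :
    ∃ G : Polynomial (LaurentRing N K), G ≠ 0 ∧ Polynomial.aeval (X j : MixedRing N M K) G ∈ I := by
  obtain ⟨q, q0, hq⟩ := IsAdmissible.exists_singleVarInclusion_mem hI j
  let e : (Fin N →₀ ℕ) →+ (Fin N → ℤ) :=
    { toFun := fun β l => (β l : ℤ), map_zero' := by ext; simp, map_add' := by intros; ext; simp }
  have he : Function.Injective e := fun a b hab => by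
    ext l
    exact Nat.cast_injective (R := ℤ) (congrFun hab l)
  let ψ : MvPolynomial (Fin N) K →+* LaurentRing N K := AddMonoidAlgebra.mapDomainRingHom K e
  have hψ : Function.Injective ψ := AddMonoidAlgebra.mapDomain_injective he
  refine ⟨q.map ψ, (Polynomial.map_ne_zero_iff hψ).2 q0, ?_⟩
  have : (Polynomial.aeval (X j : MixedRing N M K)).toRingHom.comp (Polynomial.mapRingHom ψ) =
      (polyInclusion N M K).toRingHom.comp (singleVarInclusion K j) := by
    refine Polynomial.ringHom_ext' (MvPolynomial.ringHom_ext ?_ ?_) ?_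
    · intro r
      simp [singleVarInclusion, polyInclusion]
      refine (AddMonoidAlgebra.mapDomain_single (f := e) (a := 0) (r := r)).trans ?_
      rw [map_zero]
    · intro l
      simp [singleVarInclusion, polyInclusion]
      refine congrArg C ((AddMonoidAlgebra.mapDomain_single (f := e) (a := Finsupp.single l 1)
        (r := (1 : K))).trans ?_)
      congr 1
      ext i
      by_cases h : l = i
      · subst h; simp [e]
      · simp [e, Ne.symm h]
    · simp [singleVarInclusion, polyInclusion]
  have h2 := RingHom.congr_fun this q
  simp only [RingHom.comp_apply] at h2
  change Polynomial.aeval (X j : MixedRing N M K) (q.map ψ) = _ at h2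
  rw [h2]
  exact hq

/-! ### Supports in group algebras -/

section Support

variable {K G : Type*} [Field K] [AddCommGroup G]

lemma AddMonoidAlgebra.exists_of_coeff_mul_ne_zero {a b : AddMonoidAlgebra K G} {γ : G}
    (h : (a * b).coeff γ ≠ 0) : ∃ α β, a.coeff α ≠ 0 ∧ b.coeff β ≠ 0 ∧ α + β = γ := by
  classical
  obtain ⟨α, hα, β, hβ, rfl⟩ := Finset.mem_add.1
    (AddMonoidAlgebra.support_coeff_mul_subset a b (Finsupp.mem_support_iff.2 h))
  exact ⟨α, β, Finsupp.mem_support_iff.1 hα, Finsupp.mem_support_iff.1 hβ, rfl⟩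

/-- The elements of `K[G]` whose exponents lie in `g + T`. -/
def SupportedIn (T : AddSubmonoid G) (g : G) (a : AddMonoidAlgebra K G) : Prop :=
  ∀ α, a.coeff α ≠ 0 → α - g ∈ T

lemma SupportedIn.mul {T : AddSubmonoid G} {g g' : G} {a b : AddMonoidAlgebra K G}
    (ha : SupportedIn T g a) (hb : SupportedIn T g' b) : SupportedIn T (g + g') (a * b) := by
  intro γ hγ
  obtain ⟨α, β, hα, hβ, rfl⟩ := AddMonoidAlgebra.exists_of_coeff_mul_ne_zero hγ
  have : α + β - (g + g') = (α - g) + (β - g') := by abel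
  rw [this]
  exact add_mem (ha α hα) (hb β hβ)

lemma SupportedIn.pow {T : AddSubmonoid G} {g : G} {a : AddMonoidAlgebra K G}
    (ha : SupportedIn T g a) (n : ℕ) : SupportedIn T (n • g) (a ^ n) := by
  induction n with
  | zero =>
    intro α hα
    rw [pow_zero, AddMonoidAlgebra.one_def, AddMonoidAlgebra.coeff_single] at hα
    have : α = 0 := by
      by_contra h
      exact hα (Finsupp.single_eq_of_ne h)
    simp [this]
  | succ n ih =>
    rw [pow_succ, succ_nsmul]
    exact ih.mul ha

lemma SupportedIn.sum {ι : Type*} {T : AddSubmonoid G} {g : G} {s : Finset ι}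
    {a : ι → AddMonoidAlgebra K G} (ha : ∀ i ∈ s, SupportedIn T g (a i)) :
    SupportedIn T g (∑ i ∈ s, a i) := by
  intro α hα
  rw [AddMonoidAlgebra.coeff_sum, Finsupp.finsetSum_apply] at hα
  obtain ⟨i, hi, h⟩ := Finset.exists_ne_zero_of_sum_ne_zero hα
  exact ha i hi α h

end Support

/-! ### The Newton–Puiseux process in one variable -/

section Newton

variable {K G : Type*} [Field K] [AddCommGroup G]

/-- The homogeneous component of degree `δ` of `F`, for the grading in which `x ^ α y ^ k` has
degree `α + k e`, written as a polynomial in `y`. -/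
def initForm (δ e : G) (F : Polynomial (AddMonoidAlgebra K G)) : Polynomial K :=
  ∑ k ∈ F.support, Polynomial.monomial k ((F.coeff k).coeff (δ - k • e))

lemma coeff_initForm (δ e : G) (F : Polynomial (AddMonoidAlgebra K G)) (k : ℕ) :
    (initForm δ e F).coeff k = (F.coeff k).coeff (δ - k • e) := by
  rw [initForm, Polynomial.finsetSum_coeff]
  simp only [Polynomial.coeff_monomial]
  rw [Finset.sum_ite_eq']
  split_ifs with h
  · rfl
  · rw [Polynomial.notMem_support_iff.1 h]; rfl

lemma initForm_add (δ e : G) (F H : Polynomial (AddMonoidAlgebra K G)) :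
    initForm δ e (F + H) = initForm δ e F + initForm δ e H := by
  ext k
  simp [coeff_initForm]

/-- The substitution `y ↦ y + c x ^ e` is homogeneous for this grading, so it acts on each graded
component separately. -/
lemma initForm_taylor (δ e : G) (c : K) (F : Polynomial (AddMonoidAlgebra K G)) :
    initForm δ e (Polynomial.taylor (AddMonoidAlgebra.single e c) F) =
      Polynomial.taylor c (initForm δ e F) := by
  induction F using Polynomial.induction_on' with
  | add F H hF hH => rw [map_add, initForm_add, hF, hH, initForm_add, map_add]
  | monomial k a =>
    have h1 : initForm δ e (Polynomial.monomial k a) =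
        Polynomial.monomial k (a.coeff (δ - k • e)) := by
      ext j
      rw [coeff_initForm, Polynomial.coeff_monomial, Polynomial.coeff_monomial]
      split_ifs with h
      · rw [h]
      · rfl
    rw [h1]
    ext j
    rw [coeff_initForm, Polynomial.taylor_monomial, Polynomial.taylor_monomial,
      Polynomial.coeff_C_mul, Polynomial.coeff_C_mul, Polynomial.coeff_X_add_C_pow,
      Polynomial.coeff_X_add_C_pow, AddMonoidAlgebra.single_pow, AddMonoidAlgebra.natCast_def,
      AddMonoidAlgebra.single_mul_single, AddMonoidAlgebra.coeff_mul_single_apply]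
    rcases le_or_gt j k with h | h
    · congr 2
      have : k • e = (k - j) • e + j • e := by rw [← add_nsmul, Nat.sub_add_cancel h]
      rw [this]; abel
    · simp [Nat.choose_eq_zero_of_lt h]

/-- `δ` is the exponent of least weight in `F`, for the grading in which `x ^ α y ^ k` has degree
`α + k e`. -/
def IsInitExp (w : G →+ ℝ) (e : G) (F : Polynomial (AddMonoidAlgebra K G)) (δ : G) : Prop :=
  initForm δ e F ≠ 0 ∧ ∀ k α, (F.coeff k).coeff α ≠ 0 → w δ ≤ w (α + k • e)

lemma exists_isInitExp (w : G →+ ℝ) (e : G) {F : Polynomial (AddMonoidAlgebra K G)} (hF : F ≠ 0) :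
    ∃ δ, IsInitExp w e F δ := by
  classical
  set s : Finset G := F.support.biUnion fun k => (F.coeff k).coeff.support.image (· + k • e)
    with hs
  have hmem : ∀ k α, (F.coeff k).coeff α ≠ 0 → α + k • e ∈ s := by
    intro k α h
    refine Finset.mem_biUnion.2 ⟨k, Polynomial.mem_support_iff.2 fun h0 => h (by rw [h0]; rfl),
      Finset.mem_image_of_mem _ (Finsupp.mem_support_iff.2 h)⟩
  have hne : s.Nonempty := by
    obtain ⟨k, hk⟩ := Polynomial.support_nonempty.2 hF
    obtain ⟨α, hα⟩ := Finsupp.ne_iff.1 (AddMonoidAlgebra.coeff_eq_zero.not.2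
      (Polynomial.mem_support_iff.1 hk))
    exact ⟨_, hmem k α hα⟩
  obtain ⟨δ, hδ, hmin⟩ := s.exists_min_image w hne
  refine ⟨δ, fun h0 => ?_, fun k α h => hmin _ (hmem k α h)⟩
  obtain ⟨k, -, h⟩ := Finset.mem_biUnion.1 hδ
  obtain ⟨α, hα, rfl⟩ := Finset.mem_image.1 h
  refine Finsupp.mem_support_iff.1 hα ?_
  have := congrArg (Polynomial.coeff · k) h0
  simpa [coeff_initForm] using this

lemma IsInitExp.taylor {w : G →+ ℝ} {e δ : G} {F : Polynomial (AddMonoidAlgebra K G)}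
    (h : IsInitExp w e F δ) (c : K) :
    IsInitExp w e (Polynomial.taylor (AddMonoidAlgebra.single e c) F) δ := by
  refine ⟨?_, fun k α hα => ?_⟩
  · rw [initForm_taylor, Ne, Polynomial.taylor_eq_zero]
    exact h.1
  · have h1 : initForm (α + k • e) e F ≠ 0 := by
      intro h0
      have := initForm_taylor (α + k • e) e c F
      rw [h0, map_zero] at this
      have := congrArg (Polynomial.coeff · k) this
      exact hα (by simpa [coeff_initForm] using this)
    obtain ⟨l, hl⟩ := Polynomial.support_nonempty.2 h1
    rw [Polynomial.mem_support_iff, coeff_initForm] at hl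
    simpa using h.2 l _ hl

/-- Monotonicity of the slopes of a Newton polygon: if `y ^ k` with `k > m` occurred in the second
initial form, adding the two minimality inequalities would give `0 ≤ (k - m) (w e - w e')`. -/
lemma IsInitExp.natDegree_le {w : G →+ ℝ} {e δ e' δ' : G} {F : Polynomial (AddMonoidAlgebra K G)}
    (h : IsInitExp w e F δ) (h' : IsInitExp w e' F δ') (hlt : w e < w e') {m : ℕ}
    (hm : (initForm δ e F).coeff m ≠ 0) : (initForm δ' e' F).natDegree ≤ m := by
  refine Polynomial.natDegree_le_iff_coeff_eq_zero.2 fun k hk => ?_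
  by_contra hne
  rw [coeff_initForm] at hm hne
  have h1 := h.2 k _ hne
  have h2 := h'.2 m _ hm
  simp only [map_add, map_sub, map_nsmul, nsmul_eq_mul] at h1 h2
  have h3 : (m : ℝ) < k := by exact_mod_cast hk
  nlinarith

lemma coeff_taylor_rootMultiplicity_ne_zero {f : Polynomial K} (hf : f ≠ 0) (c : K) :
    (Polynomial.taylor c f).coeff (f.rootMultiplicity c) ≠ 0 := by
  rw [Polynomial.rootMultiplicity_eq_natTrailingDegree, ← Polynomial.taylor_apply]
  exact Polynomial.trailingCoeff_nonzero_iff_nonzero.2 ((Polynomial.taylor_eq_zero c f).not.2 hf)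

/-- Here `f = a (X - c) ^ m`, whose coefficient of degree `m - 1` is `-m c a`. This is where
characteristic zero enters. -/
lemma coeff_natDegree_sub_one_ne_zero [CharZero K] {f : Polynomial K} {c : K} (hf : f ≠ 0)
    (hc : c ≠ 0) (h : f.rootMultiplicity c = f.natDegree) (h1 : 1 ≤ f.natDegree) :
    f.coeff (f.natDegree - 1) ≠ 0 := by
  obtain ⟨q, hq⟩ := Polynomial.pow_rootMultiplicity_dvd f c
  rw [h] at hq
  have q0 : q ≠ 0 := by
    rintro rfl
    exact hf (by rw [hq, mul_zero])
  have hd : q.natDegree = 0 := by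
    have := congrArg Polynomial.natDegree hq
    rw [Polynomial.natDegree_mul (pow_ne_zero _ (Polynomial.X_sub_C_ne_zero c)) q0,
      Polynomial.natDegree_pow, Polynomial.natDegree_X_sub_C] at this
    omega
  obtain ⟨a, rfl⟩ := Polynomial.natDegree_eq_zero.1 hd
  have ha : a ≠ 0 := by
    rintro rfl
    exact q0 (map_zero _)
  set m := f.natDegree
  rw [hq, Polynomial.coeff_mul_C, sub_eq_add_neg, ← map_neg, Polynomial.coeff_X_add_C_pow, Nat.choose_symm h1,
    Nat.sub_sub_self h1, Nat.choose_one_right, pow_one]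
  exact mul_ne_zero (mul_ne_zero (neg_ne_zero.2 hc) (Nat.cast_ne_zero.2 (by omega))) ha

/-- If successive terms `c_i x ^ {e_i}` of increasing weight are produced by the Newton–Puiseux
process from a nonzero polynomial `F`, the exponents eventually lie in a translate of a finitely
generated monoid of nonnegative weights. -/
theorem exists_exponents_mem_closure [CharZero K] (w : G →+ ℝ) (hw : Function.Injective w)
    {F : Polynomial (AddMonoidAlgebra K G)} (hF : F ≠ 0) (e : ℕ → G) (c : ℕ → K)
    (hc : ∀ i, c i ≠ 0) (he : ∀ i, w (e i) < w (e (i + 1))) (p : ℕ → AddMonoidAlgebra K G)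
    (hp : ∀ i, p (i + 1) = p i + AddMonoidAlgebra.single (e i) (c i))
    (H : ∀ i γ, (F.eval (p (i + 1))).coeff γ ≠ 0 → ∃ k α,
      ((Polynomial.taylor (p i) F).coeff k).coeff α ≠ 0 ∧ w (α + k • e i) < w γ) :
    ∃ (s : ℕ) (T : Finset G), (∀ t ∈ T, 0 ≤ w t) ∧
      ∀ i, s ≤ i → e i - e s ∈ AddSubmonoid.closure (T : Set G) := by
  classical
  have hstep : ∀ i, Polynomial.taylor (p (i + 1)) F =
      Polynomial.taylor (AddMonoidAlgebra.single (e i) (c i)) (Polynomial.taylor (p i) F) := by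
    intro i
    rw [Polynomial.taylor_taylor, hp, add_comm]
  choose δ hδ using fun i => exists_isInitExp w (e i) ((Polynomial.taylor_eq_zero (p i) F).not.2 hF)
  set f : ℕ → Polynomial K := fun i => initForm (δ i) (e i) (Polynomial.taylor (p i) F) with hf
  have hδ' : ∀ i, IsInitExp w (e i) (Polynomial.taylor (p (i + 1)) F) (δ i) := by
    intro i
    rw [hstep]
    exact (hδ i).taylor _
  have hf' : ∀ i, initForm (δ i) (e i) (Polynomial.taylor (p (i + 1)) F) =
      Polynomial.taylor (c i) (f i) := by
    intro i
    rw [hstep, initForm_taylor]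
  have hroot : ∀ i, (f i).IsRoot (c i) := by
    intro i
    have h1 : (f i).eval (c i) = (F.eval (p (i + 1))).coeff (δ i) := by
      rw [← Polynomial.taylor_coeff_zero, ← hf' i, coeff_initForm, Polynomial.taylor_coeff_zero,
        zero_nsmul, sub_zero]
    by_contra h0
    rw [Polynomial.IsRoot, h1] at h0
    obtain ⟨k, α, hα, hlt⟩ := H i _ h0
    exact absurd ((hδ i).2 k α hα) (not_le.2 hlt)
  set m : ℕ → ℕ := fun i => (f i).rootMultiplicity (c i) with hm
  have hm1 : ∀ i, 1 ≤ m i := fun i => (Polynomial.rootMultiplicity_pos (hδ i).1).2 (hroot i)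
  have hcm : ∀ i, (initForm (δ i) (e i) (Polynomial.taylor (p (i + 1)) F)).coeff (m i) ≠ 0 := by
    intro i
    rw [hf']
    exact coeff_taylor_rootMultiplicity_ne_zero (hδ i).1 _
  -- After the shift by `c_i`, the initial form for the weight of `e_i` contains `y ^ (m i)`;
  -- passing to the larger weight of `e_{i+1}` bounds the degree. Since `m (i + 1)` is at most that
  -- degree, the multiplicities decrease.
  have hdeg : ∀ i, (f (i + 1)).natDegree ≤ m i := fun i =>
    (hδ' i).natDegree_le (hδ (i + 1)) (he i) (hcm i)
  have hmdeg : ∀ i, m i ≤ (f i).natDegree := fun i => by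
    rw [← Polynomial.natDegree_taylor (f i) (c i)]
    exact Polynomial.le_natDegree_of_ne_zero (coeff_taylor_rootMultiplicity_ne_zero (hδ i).1 _)
  have hanti : Antitone m := antitone_nat_of_succ_le fun i => (hmdeg (i + 1)).trans (hdeg i)
  obtain ⟨n, hn⟩ : ∃ n, ∀ i, n ≤ i → m i = m n := by
    obtain ⟨n, hn⟩ := exists_minimal_of_wellFoundedLT (fun k => k ∈ Set.range m) ⟨m 0, 0, rfl⟩
    obtain ⟨⟨n, rfl⟩, hn⟩ := hn
    exact ⟨n, fun i hi => le_antisymm (hanti hi) (hn ⟨i, rfl⟩ (hanti hi))⟩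
  set μ := m n with hμ
  -- The index is shifted by one because the degree at `i + 1` is bounded by the multiplicity at
  -- `i`. Degree and multiplicity now agree, so `f_i` is a constant times `(y - c_i) ^ μ`.
  have hdeg' : ∀ i, n + 1 ≤ i → (f i).natDegree = μ := by
    intro i hi
    obtain ⟨i, rfl⟩ : ∃ k, i = k + 1 := ⟨i - 1, by omega⟩
    refine le_antisymm ((hdeg i).trans (hn i (by omega)).le) ?_
    rw [← hn (i + 1) (by omega)]
    exact hmdeg _
  set s := n + 1 with hs
  set β := δ s - μ • e s with hβ
  -- The vertex `x ^ β y ^ μ` of the Newton polygon no longer moves: the two minimality conditions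
  -- give equal weights, and `w` is injective.
  have hβi : ∀ i, s ≤ i → δ i - μ • e i = β := by
    intro i hi
    induction i, hi using Nat.le_induction with
    | base => rfl
    | succ i hi ih =>
      rw [← ih]
      apply hw
      have h1 := hcm i
      rw [coeff_initForm, hn i (by omega)] at h1
      have h2 : (f (i + 1)).coeff μ ≠ 0 := by
        rw [← hdeg' (i + 1) (by omega)]
        exact Polynomial.leadingCoeff_ne_zero.2 (hδ (i + 1)).1
      rw [hf, coeff_initForm] at h2
      have h3 := (hδ (i + 1)).2 _ _ h1
      have h4 := (hδ' i).2 _ _ h2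
      simp only [map_add, map_sub, map_nsmul] at h3 h4 ⊢
      linarith
  -- The nonzero coefficient of `y ^ (μ - 1)` in `f_i` is a coefficient of the Hasse derivative at
  -- `p_i`, at the exponent `δ_i - (μ - 1) e_i = β + e_i`.
  have hsub : ∀ i, s ≤ i → ((Polynomial.hasseDeriv (μ - 1) F).eval (p i)).coeff (β + e i) ≠ 0 := by
    intro i hi
    have h1 := coeff_natDegree_sub_one_ne_zero (hδ i).1 (hc i)
      (by rw [hdeg' i hi]; exact hn i (by omega)) (by rw [hdeg' i hi]; exact hm1 n)
    rw [hdeg' i hi, coeff_initForm, Polynomial.taylor_coeff] at h1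
    have h2 : δ i - (μ - 1) • e i = β + e i := by
      have : μ • e i = (μ - 1) • e i + e i := by
        rw [← succ_nsmul, Nat.sub_add_cancel (hm1 n)]
      rw [← hβi i hi, this]; abel
    rwa [h2] at h1
  -- Recentring at `p_s` gives a fixed polynomial whose finitely many terms generate the monoid. Its
  -- coefficients are binomial multiples of those of `F(y + p_s)` of degree higher by `μ - 1`, so
  -- minimality of `δ_s` makes the generators nonnegative.
  set Q := Polynomial.taylor (p s) (Polynomial.hasseDeriv (μ - 1) F) with hQ
  have hQw : ∀ k α, (Q.coeff k).coeff α ≠ 0 → 0 ≤ w (α + k • e s - (β + e s)) := by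
    intro k α h
    have h1 : Q.coeff k = (k + (μ - 1)).choose k • (Polynomial.taylor (p s) F).coeff (k + (μ - 1)) := by
      rw [hQ, Polynomial.taylor_coeff, ← LinearMap.comp_apply, Polynomial.hasseDeriv_comp,
        LinearMap.smul_apply, Polynomial.eval_smul, Polynomial.taylor_coeff]
    rw [h1] at h
    have h2 : ((Polynomial.taylor (p s) F).coeff (k + (μ - 1))).coeff α ≠ 0 := by
      intro h0
      apply h
      rw [nsmul_eq_mul, AddMonoidAlgebra.natCast_def, AddMonoidAlgebra.coeff_single_mul_apply]
      simp [h0]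
    have h3 := (hδ s).2 _ _ h2
    have h4 : δ s = β + μ • e s := by rw [hβ]; abel
    have h5 : ((μ - 1 : ℕ) : ℝ) = μ - 1 := by
      rw [Nat.cast_sub (hm1 n), Nat.cast_one]
    rw [h4] at h3
    simp only [map_add, map_sub, map_nsmul, nsmul_eq_mul, Nat.cast_add, h5] at h3 ⊢
    linarith
  refine ⟨s, Q.support.biUnion fun k => (Q.coeff k).coeff.support.image
    fun α => α + k • e s - (β + e s), ?_, ?_⟩
  · intro t ht
    obtain ⟨k, -, h⟩ := Finset.mem_biUnion.1 ht
    obtain ⟨α, hα, rfl⟩ := Finset.mem_image.1 h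
    exact hQw k α (Finsupp.mem_support_iff.1 hα)
  set T := AddSubmonoid.closure ((Q.support.biUnion fun k => (Q.coeff k).coeff.support.image
    fun α => α + k • e s - (β + e s) : Finset G) : Set G) with hT
  have hQT : ∀ k, SupportedIn T (β + e s - k • e s) (Q.coeff k) := by
    intro k α h
    have : α - (β + e s - k • e s) = α + k • e s - (β + e s) := by abel
    rw [this]
    refine AddSubmonoid.subset_closure (Finset.mem_coe.2 (Finset.mem_biUnion.2 ⟨k,
      Polynomial.mem_support_iff.2 fun h0 => h (by rw [h0]; rfl),
      Finset.mem_image.2 ⟨α, Finsupp.mem_support_iff.2 h, rfl⟩⟩))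
  intro i hi
  induction i using Nat.strong_induction_on with
  | _ i ih =>
    -- Only exponents of index below `i` occur in `p_i - p_s`, so the strong induction hypothesis
    -- applies to all of them.
    have hq : ∀ k, s ≤ k → k ≤ i → SupportedIn T (e s) (p k - p s) := by
      intro k hk
      induction k, hk using Nat.le_induction with
      | base =>
        intro _ α hα
        rw [sub_self] at hα
        exact absurd rfl hα
      | succ k hk ihk =>
        intro hki α hα
        have h1 : p (k + 1) - p s = (p k - p s) + AddMonoidAlgebra.single (e k) (c k) := by
          rw [hp]; abel
        rw [h1, AddMonoidAlgebra.coeff_add, Finsupp.add_apply] at hα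
        by_cases h2 : (p k - p s).coeff α = 0
        · rw [h2, zero_add, AddMonoidAlgebra.coeff_single] at hα
          have : α = e k := by
            by_contra h
            exact hα (Finsupp.single_eq_of_ne h)
          rw [this]
          exact ih k (by omega) hk
        · exact ihk (by omega) α h2
    have h1 : (Polynomial.hasseDeriv (μ - 1) F).eval (p i) = Q.eval (p i - p s) := by
      rw [hQ, Polynomial.taylor_eval_sub]
    have h2 := hsub i hi
    rw [h1, Polynomial.eval_eq_sum, Polynomial.sum_def] at h2
    -- The shift `-k e_s` in the coefficient of `y ^ k` compensates the shift `k e_s` of `(p_i -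
    -- p_s) ^ k`, so every summand has support in `β + e_s + T`.
    have h3 : SupportedIn T (β + e s) (∑ k ∈ Q.support, Q.coeff k * (p i - p s) ^ k) := by
      refine SupportedIn.sum fun k _ => ?_
      have := (hQT k).mul ((hq i hi le_rfl).pow k)
      rwa [sub_add_cancel] at this
    have := h3 _ h2
    rwa [add_sub_add_left_eq_sub] at this

end Newton

/-! ### Fractional Laurent polynomials -/

section FracRing

variable {N M : ℕ} {K : Type*} [Field K]

/-- Laurent polynomials with rational exponents. -/
abbrev FracRing (N : ℕ) (K : Type*) [Field K] : Type _ := AddMonoidAlgebra K (Fin N → ℚ)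

/-- The weight `α ↦ ω · α`, as a homomorphism. -/
def omegaHom (ω : Fin N → ℝ) : (Fin N → ℚ) →+ ℝ where
  toFun := omegaDot ω
  map_zero' := by simp [omegaDot]
  map_add' a b := omegaDot_add ω a b

lemma omegaHom_injective {ω : Fin N → ℝ} (hω : LinearIndependent ℚ ω) :
    Function.Injective (omegaHom ω) := by
  rw [injective_iff_map_eq_zero]
  intro a ha
  funext l
  refine Fintype.linearIndependent_iff.1 hω a ?_ l
  rw [← ha]
  exact Finset.sum_congr rfl fun i _ => by rw [Rat.smul_def, mul_comm]

lemma omegaHom_smul (ω : Fin N → ℝ) (r : ℚ) (a : Fin N → ℚ) :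
    omegaHom ω (r • a) = r * omegaHom ω a := by
  change ∑ l, ω l * ((r * a l : ℚ) : ℝ) = r * ∑ l, ω l * (a l : ℝ)
  rw [Finset.mul_sum]
  refine Finset.sum_congr rfl fun l _ => ?_
  push_cast; ring

/-- The exponent `r α`, for an integral exponent `α`. -/
def scaleHom (N : ℕ) (r : ℚ) : (Fin N → ℤ) →+ (Fin N → ℚ) where
  toFun α := r • fun l => (α l : ℚ)
  map_zero' := by ext; simp
  map_add' a b := by ext; simp [mul_add]

/-- The substitution `x ↦ x ^ {r I}`, from Laurent polynomials to fractional ones. -/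
def fracEmb (N : ℕ) (K : Type*) [Field K] (r : ℚ) : LaurentRing N K →+* FracRing N K :=
  AddMonoidAlgebra.mapDomainRingHom K (scaleHom N r)

lemma fracEmb_single (r : ℚ) (α : Fin N → ℤ) (a : K) :
    fracEmb N K r (AddMonoidAlgebra.single α a) = AddMonoidAlgebra.single (scaleHom N r α) a :=
  AddMonoidAlgebra.mapDomain_single

lemma fracEmb_injective {r : ℚ} (hr : r ≠ 0) : Function.Injective (fracEmb N K r) := by
  refine AddMonoidAlgebra.mapDomain_injective fun a b h => funext fun l => ?_
  have := congrFun h l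
  simpa [scaleHom, hr] using this

lemma fracEmb_comp_ramify (r : ℚ) (d : ℕ) :
    (fracEmb N K r).comp (ramify N K d) = fracEmb N K (r * d) := by
  refine AddMonoidAlgebra.ringHom_ext (fun a => ?_) (fun α => ?_)
  · have : ramify N K d (AddMonoidAlgebra.single 0 a) = AddMonoidAlgebra.single 0 a :=
      AddMonoidAlgebra.mapDomain_single.trans (by simp)
    rw [RingHom.comp_apply, this, fracEmb_single, fracEmb_single]
    simp
  · have : ramify N K d (AddMonoidAlgebra.single α 1) = AddMonoidAlgebra.single (d • α) 1 :=
      AddMonoidAlgebra.mapDomain_single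
    rw [RingHom.comp_apply, this, fracEmb_single, fracEmb_single]
    congr 1
    ext l
    simp [scaleHom, mul_assoc]

/-- The `i`-th row of `Γ`, with `0` in place of `∞`. -/
def OmegaData.exponent {N M : ℕ} {K : Type*} (D : OmegaData N M K) (i : Fin M) : Fin N → ℚ :=
  fun l => (D.Γ i l).untopD 0

/-- The monomial `c_i x ^ {r Γ_i}`, as a fractional Laurent polynomial. -/
def OmegaData.term (D : OmegaData N M K) (r : ℚ) (i : Fin M) : FracRing N K :=
  AddMonoidAlgebra.single (r • D.exponent i) (D.c i)

lemma OmegaData.d_pos {N M : ℕ} {K : Type*} (D : OmegaData N M K) : 0 < D.d :=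
  Nat.pos_of_ne_zero (Finset.lcm_ne_zero_iff.2 fun _ _ => Rat.den_nz _)

lemma OmegaData.num_d_mul {N M : ℕ} {K : Type*} (D : OmegaData N M K) (i : Fin M) (l : Fin N) :
    ((((D.d : ℚ) * (D.Γ i l).untopD 0).num : ℤ) : ℚ) = D.d * D.exponent i l := by
  have h : ((D.Γ i l).untopD 0).den ∣ D.d :=
    Finset.dvd_lcm (f := fun p : Fin M × Fin N => ((D.Γ p.1 p.2).untopD 0).den)
      (Finset.mem_univ (i, l))
  obtain ⟨m, hm⟩ := h
  have h1 : (D.d : ℚ) * (D.Γ i l).untopD 0 = ((m * ((D.Γ i l).untopD 0).num : ℤ) : ℚ) := by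
    rw [hm]
    push_cast
    linear_combination (m : ℚ) * Rat.mul_den_eq_num ((D.Γ i l).untopD 0)
  rw [h1, Rat.num_intCast, ← h1]
  rfl

/-- Evaluating `f(x ^ {d I}, y + 𝔐_D(x ^ {d I}))` at `(x ^ {r I}, y)` amounts to evaluating `f` at
`(x ^ {r d I}, y + 𝔐_D(x ^ {r d I}))`. -/
lemma OmegaData.eval₂_subst {R : Type*} [CommRing R] (D : OmegaData N M K)
    (g : FracRing N K →+* R) (r : ℚ) (y : Fin M → R) (f : MixedRing N M K) :
    eval₂ (g.comp (fracEmb N K r)) y (D.subst f) =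
      eval₂ (g.comp (fracEmb N K (r * D.d))) (fun j => y j + g (D.term (r * D.d) j)) f := by
  have : (eval₂Hom (g.comp (fracEmb N K r)) y).comp D.subst =
      eval₂Hom (g.comp (fracEmb N K (r * D.d))) (fun j => y j + g (D.term (r * D.d) j)) := by
    refine MvPolynomial.ringHom_ext (fun a => ?_) (fun j => ?_)
    · simp only [OmegaData.subst, RingHom.comp_apply, eval₂Hom_C]
      rw [← fracEmb_comp_ramify, RingHom.comp_apply]
    · simp only [OmegaData.subst, RingHom.comp_apply, eval₂Hom_X', map_add, mixedMonomial]
      congr 1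
      change eval₂Hom (g.comp (fracEmb N K r)) y (C _) = _
      rw [eval₂Hom_C, RingHom.comp_apply, fracEmb_single, OmegaData.term]
      congr 2
      ext l
      simp only [scaleHom, AddMonoidHom.coe_mk, ZeroHom.coe_mk, Pi.smul_apply, smul_eq_mul,
        D.num_d_mul]
      ring
  exact RingHom.congr_fun this f

end FracRing

/-! ### Starting `ω`-sets -/

section Starting

variable {N M : ℕ} {K : Type*} [Field K] {ω : Fin N → ℝ}

/-- Rational independence makes every `ω l` nonzero, so a single entry `∞` in a row would already
force `η_j = ∞`. -/
lemma IsOmegaSet.eta_eq (hω : LinearIndependent ℚ ω) {D : OmegaData N M K} (hD : IsOmegaSet ω D)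
    {j : Fin M} (hj : D.η j ≠ ⊤) : D.η j = ((omegaHom ω (D.exponent j) : ℝ) : WithTop ℝ) := by
  have h := hD.1 j
  have hne : ∀ l, D.Γ j l ≠ ⊤ := by
    intro l hl
    apply hj
    rw [← h]
    refine WithTop.sum_eq_top.2 ⟨l, Finset.mem_univ l, ?_⟩
    rw [hl, WithTop.map_top]
    exact WithTop.mul_top (by exact_mod_cast hω.ne_zero l)
  rw [← h]
  change _ = ((∑ l, ω l * (D.exponent j l : ℝ) : ℝ) : WithTop ℝ)
  rw [WithTop.coe_sum]
  refine Finset.sum_congr rfl fun l _ => ?_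
  obtain ⟨q, hq⟩ := WithTop.ne_top_iff_exists.1 (hne l)
  rw [OmegaData.exponent, ← hq]
  simp

/-- The exponent of the monomial `x ^ α y ^ β` evaluated at `y = 𝔐_D(x)`. -/
def OmegaData.totalExponent (D : OmegaData N M K) (α : Fin N → ℤ) (β : Fin M →₀ ℕ) : Fin N → ℚ :=
  (fun l => (α l : ℚ)) + ∑ j, β j • D.exponent j

/-- The condition on `β` excludes the variables of infinite order; for these `exponent` has the
default value `0` and says nothing about the weight. -/
lemma IsOmegaSet.mixedWeight_eq (hω : LinearIndependent ℚ ω) {D : OmegaData N M K}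
    (hD : IsOmegaSet ω D) (α : Fin N → ℤ) {β : Fin M →₀ ℕ} (hβ : ∏ j, D.c j ^ β j ≠ 0) :
    mixedWeight ω D.η α β = ((omegaHom ω (D.totalExponent α β) : ℝ) : WithTop ℝ) := by
  rw [mixedWeight, OmegaData.totalExponent, map_add, map_sum, WithTop.coe_add]
  congr 1
  · rw [WithTop.coe_sum]
    refine Finset.sum_congr rfl fun j _ => ?_
    rcases Nat.eq_zero_or_pos (β j) with h | h
    · simp [h]
    · have hc : D.c j ≠ 0 := fun h0 => Finset.prod_ne_zero_iff.1 hβ j (Finset.mem_univ j)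
        (by rw [h0, zero_pow h.ne'])
      rw [hD.eta_eq hω ((hD.2.2 j).1 hc), map_nsmul, nsmul_eq_mul, mul_comm, WithTop.coe_mul]

lemma OmegaData.eval₂_term (D : OmegaData N M K) (r : ℚ) (f : MixedRing N M K) :
    eval₂ (fracEmb N K r) (D.term r) f = ∑ β ∈ f.support, ∑ α ∈ (coeff β f).coeff.support,
      AddMonoidAlgebra.single (r • D.totalExponent α β)
        ((coeff β f).coeff α * ∏ j, D.c j ^ β j) := by
  rw [eval₂_eq']
  refine Finset.sum_congr rfl fun β _ => ?_
  have h1 : ∏ j, D.term r j ^ β j =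
      AddMonoidAlgebra.single (∑ j, β j • r • D.exponent j) (∏ j, D.c j ^ β j) := by
    simp only [OmegaData.term, AddMonoidAlgebra.single_pow]
    rw [AddMonoidAlgebra.prod_single]
  have h2 : fracEmb N K r (coeff β f) = ∑ α ∈ (coeff β f).coeff.support,
      AddMonoidAlgebra.single (scaleHom N r α) ((coeff β f).coeff α) := by
    conv_lhs => rw [← AddMonoidAlgebra.sum_coeff_single (coeff β f), Finsupp.sum, map_sum]
    exact Finset.sum_congr rfl fun α _ => fracEmb_single _ _ _
  rw [h1, h2, Finset.sum_mul]
  refine Finset.sum_congr rfl fun α _ => ?_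
  rw [AddMonoidAlgebra.single_mul_single]
  congr 1
  rw [OmegaData.totalExponent, smul_add, Finset.smul_sum]
  congr 1
  exact Finset.sum_congr rfl fun j _ => smul_comm _ _ _

lemma eval₂_evalOne_mixedMonomial (c : Fin M → K) (α : Fin N → ℤ) (β : Fin M →₀ ℕ) (a : K) :
    eval₂ (evalOne N K : LaurentRing N K →+* K) c (mixedMonomial α β a) = a * ∏ j, c j ^ β j := by
  rw [mixedMonomial, eval₂_monomial, Finsupp.prod_fintype _ _ fun j => pow_zero _]
  congr 1
  change evalOne N K _ = a
  rw [evalOne, AddMonoidAlgebra.lift_single]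
  simp

/-- The coefficient of `f(x ^ {r I}, 𝔐_D(x ^ {r I}))` at an exponent of the weight of the initial
part of `f` is the value of this initial part at `(1, …, 1, c)`. -/
lemma IsOmegaSet.coeff_eval₂_term (hω : LinearIndependent ℚ ω) {D : OmegaData N M K}
    (hD : IsOmegaSet ω D) {r : ℚ} (hr : 0 < r) {f : MixedRing N M K} {v : ℝ}
    (hv : mixedOrder ω D.η f = (v : WithTop ℝ)) {γ : Fin N → ℚ} (hγ : omegaHom ω γ = r * v) :
    (eval₂ (fracEmb N K r) (D.term r) f).coeff γ =
      eval₂ (evalOne N K : LaurentRing N K →+* K) D.c (initialPart ω D.η f) := by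
  classical
  rw [initialPart, if_neg (by rw [hv]; exact WithTop.coe_ne_top), D.eval₂_term,
    AddMonoidAlgebra.coeff_sum, Finsupp.finsetSum_apply, ← coe_eval₂Hom, map_sum]
  refine Finset.sum_congr rfl fun β _ => ?_
  rw [AddMonoidAlgebra.coeff_sum, Finsupp.finsetSum_apply, map_sum]
  refine Finset.sum_congr rfl fun α _ => ?_
  rw [AddMonoidAlgebra.coeff_single, apply_ite (eval₂Hom _ _), map_zero, coe_eval₂Hom,
    eval₂_evalOne_mixedMonomial, Finsupp.single_apply]
  -- Terms involving a `y_j` with `c_j = 0` contribute zero on both sides. For the others,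
  -- injectivity of the weight turns equality of weights into equality of exponents.
  by_cases h0 : ∏ j, D.c j ^ β j = 0
  · simp [h0]
  · refine if_congr ?_ rfl rfl
    rw [hD.mixedWeight_eq hω α h0, hv, WithTop.coe_eq_coe, ← (omegaHom_injective hω).eq_iff,
      omegaHom_smul, hγ]
    exact mul_right_inj' (by exact_mod_cast hr.ne')

lemma mixedOrder_le {η : Fin M → WithTop ℝ} {f : MixedRing N M K} {α : Fin N → ℤ}
    {β : Fin M →₀ ℕ} (h : (coeff β f).coeff α ≠ 0) :
    mixedOrder ω η f ≤ mixedWeight ω η α β := by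
  have hβ : β ∈ f.support := mem_support_iff.2 fun h0 => h (by rw [h0]; rfl)
  exact (Finset.inf_le hβ).trans (Finset.inf_le (Finsupp.mem_support_iff.2 h))

lemma exists_mixedWeight_eq_mixedOrder {η : Fin M → WithTop ℝ} {f : MixedRing N M K}
    (h : mixedOrder ω η f ≠ ⊤) : ∃ β α, (coeff β f).coeff α ≠ 0 ∧
      mixedWeight ω η α β = mixedOrder ω η f := by
  have hne : f.support.Nonempty := by
    by_contra h0
    rw [Finset.not_nonempty_iff_eq_empty] at h0
    exact h (by rw [mixedOrder, h0, Finset.inf_empty])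
  obtain ⟨β, hβ, h1⟩ := Finset.exists_mem_eq_inf f.support hne
    fun β => (coeff β f).coeff.support.inf fun α => mixedWeight ω η α β
  have hne' : (coeff β f).coeff.support.Nonempty := by
    by_contra h0
    rw [Finset.not_nonempty_iff_eq_empty] at h0
    exact h (by rw [mixedOrder, h1, h0, Finset.inf_empty])
  obtain ⟨α, hα, h2⟩ := Finset.exists_mem_eq_inf _ hne' fun α => mixedWeight ω η α β
  exact ⟨β, α, Finsupp.mem_support_iff.1 hα, by rw [mixedOrder, h1, h2]⟩

/-- `𝔐_D` cancels the initial part of `f`: every exponent of `f(x ^ {r I}, 𝔐_D(x ^ {r I}))` has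
weight larger than that of some term of `f`. -/
def OmegaData.CancelsInitial (ω : Fin N → ℝ) (D : OmegaData N M K) (r : ℚ)
    (f : MixedRing N M K) : Prop :=
  ∀ γ, (eval₂ (fracEmb N K r) (D.term r) f).coeff γ ≠ 0 → ∃ β α, (coeff β f).coeff α ≠ 0 ∧
    ∃ v : ℝ, mixedWeight ω D.η α β = (v : WithTop ℝ) ∧ r * v < omegaHom ω γ

/-- An exponent of the value comes from a term of finite weight. If that weight is the order of `f`,
the coefficient is the initial part at `(1, …, 1, c)`, which vanishes; otherwise a term of least
weight is the required witness. -/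
lemma IsStartingOmegaSet.cancelsInitial (hω : LinearIndependent ℚ ω) {D : OmegaData N M K}
    {I : Ideal (MixedRing N M K)} (hD : IsStartingOmegaSet ω I D) {r : ℚ} (hr : 0 < r)
    {f : MixedRing N M K} (hf : f ∈ I) : D.CancelsInitial ω r f := by
  classical
  intro γ hγ
  have hr' : (0 : ℝ) < r := by exact_mod_cast hr
  obtain ⟨β, α, h0, hβ, hγe⟩ : ∃ β α, (coeff β f).coeff α ≠ 0 ∧ ∏ j, D.c j ^ β j ≠ 0 ∧
      r • D.totalExponent α β = γ := by
    rw [D.eval₂_term, AddMonoidAlgebra.coeff_sum, Finsupp.finsetSum_apply] at hγ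
    obtain ⟨β, -, hβ⟩ := Finset.exists_ne_zero_of_sum_ne_zero hγ
    rw [AddMonoidAlgebra.coeff_sum, Finsupp.finsetSum_apply] at hβ
    obtain ⟨α, -, hα⟩ := Finset.exists_ne_zero_of_sum_ne_zero hβ
    rw [AddMonoidAlgebra.coeff_single, Finsupp.single_apply, ite_ne_right_iff] at hα
    exact ⟨β, α, left_ne_zero_of_mul hα.2, right_ne_zero_of_mul hα.2, hα.1⟩
  have hle := mixedOrder_le (ω := ω) (η := D.η) h0
  rw [hD.1.mixedWeight_eq hω α hβ] at hle
  have htop : mixedOrder ω D.η f ≠ ⊤ := fun h => by simp [h] at hle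
  obtain ⟨v, hv⟩ := WithTop.ne_top_iff_exists.1 htop
  rw [← hv, WithTop.coe_le_coe] at hle
  have hγw : omegaHom ω γ = r * omegaHom ω (D.totalExponent α β) := by
    rw [← hγe, omegaHom_smul]
  rcases hle.lt_or_eq with hlt | heq
  · obtain ⟨β', α', h1, h2⟩ := exists_mixedWeight_eq_mixedOrder htop
    refine ⟨β', α', h1, v, h2.trans hv.symm, ?_⟩
    rw [hγw]
    exact mul_lt_mul_of_pos_left hlt hr'
  · refine absurd ?_ hγ
    rw [hD.1.coeff_eval₂_term hω hr hv.symm (by rw [hγw, heq])]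
    exact hD.2.2 _ (Ideal.subset_span (Or.inl ⟨f, hf, rfl⟩))

/-- If an initial part did not vanish at `(1, …, 1, c)`, its value would be a coefficient at the
weight of the order of `f`, against cancellation. The tropical condition is then automatic, since a
monomial without the variables of infinite order does not vanish at this point. -/
lemma isStartingOmegaSet_of_cancelsInitial (hω : LinearIndependent ℚ ω) {D : OmegaData N M K}
    {I : Ideal (MixedRing N M K)} (hD : IsOmegaSet ω D) {r : ℚ} (hr : 0 < r)
    (H : ∀ f ∈ I, D.CancelsInitial ω r f) : IsStartingOmegaSet ω I D := by
  classical
  have hr' : (0 : ℝ) < r := by exact_mod_cast hr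
  have hker : initialIdeal ω D.η I ≤
      RingHom.ker (eval₂Hom (evalOne N K : LaurentRing N K →+* K) D.c) := by
    refine Ideal.span_le.2 ?_
    rintro g (⟨f, hf, rfl⟩ | ⟨j, hj, rfl⟩)
    · rw [SetLike.mem_coe, RingHom.mem_ker, coe_eval₂Hom]
      by_contra hne
      have htop : mixedOrder ω D.η f ≠ ⊤ := by
        intro h
        rw [initialPart, if_pos h, eval₂_zero] at hne
        exact hne rfl
      obtain ⟨v, hv⟩ := WithTop.ne_top_iff_exists.1 htop
      obtain ⟨β, α, hβ, hw⟩ : ∃ β α, ∏ j, D.c j ^ β j ≠ 0 ∧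
          mixedWeight ω D.η α β = mixedOrder ω D.η f := by
        rw [initialPart, if_neg htop, ← coe_eval₂Hom, map_sum] at hne
        obtain ⟨β, -, hβ⟩ := Finset.exists_ne_zero_of_sum_ne_zero hne
        rw [map_sum] at hβ
        obtain ⟨α, -, hα⟩ := Finset.exists_ne_zero_of_sum_ne_zero hβ
        rw [apply_ite (eval₂Hom _ _), map_zero, ite_ne_right_iff, coe_eval₂Hom,
          eval₂_evalOne_mixedMonomial] at hα
        exact ⟨β, α, right_ne_zero_of_mul hα.2, hα.1⟩
      rw [hD.mixedWeight_eq hω α hβ, ← hv, WithTop.coe_eq_coe] at hw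
      have hγ : omegaHom ω (r • D.totalExponent α β) = r * v := by rw [omegaHom_smul, hw]
      rw [← hD.coeff_eval₂_term hω hr hv.symm hγ] at hne
      obtain ⟨β', α', h1, v', hv', hlt⟩ := H f hf _ hne
      have h2 := mixedOrder_le (ω := ω) (η := D.η) h1
      rw [hv', ← hv, WithTop.coe_le_coe] at h2
      rw [hγ] at hlt
      exact absurd (lt_of_mul_lt_mul_left hlt hr'.le) (not_lt.2 h2)
    · rw [SetLike.mem_coe, RingHom.mem_ker, eval₂Hom_X']
      by_contra h
      exact (hD.2.2 j).1 h hj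
  refine ⟨hD, fun α β a ha hβ hmem => ?_, fun f hf => hker hf⟩
  have h1 := hker hmem
  rw [RingHom.mem_ker, coe_eval₂Hom, eval₂_evalOne_mixedMonomial] at h1
  refine mul_ne_zero ha (Finset.prod_ne_zero_iff.2 fun j _ => ?_) h1
  by_cases hj : D.η j = ⊤
  · rw [hβ j hj, pow_zero]
    exact one_ne_zero
  · exact pow_ne_zero _ ((hD.2.2 j).2 hj)

end Starting

/-! ### The polynomials of an `ω`-sequence -/

section Sequence

variable {N M : ℕ} {K : Type*} [Field K] {ω : Fin N → ℝ}

/-- The successive substitutions of a polynomial along a sequence of `ω`-sets. -/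
def polySeq (S : ℕ → OmegaData N M K) (f : MixedRing N M K) : ℕ → MixedRing N M K
  | 0 => f
  | i + 1 => (S i).subst (polySeq S f i)

lemma polySeq_mem {I : Ideal (MixedRing N M K)} (S : ℕ → OmegaData N M K) {f : MixedRing N M K}
    (hf : f ∈ I) (i : ℕ) : polySeq S f i ∈ idealSeq I S i := by
  induction i with
  | zero => exact hf
  | succ i ih => exact Ideal.subset_span ⟨_, ih, rfl⟩

lemma ramIndex_pos {N M : ℕ} {K : Type*} (S : ℕ → OmegaData N M K) (i : ℕ) :
    0 < ramIndex S i :=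
  one_div_pos.2 (Finset.prod_pos fun j _ => Nat.cast_pos.2 (S j).d_pos)

lemma ramIndex_zero {N M : ℕ} {K : Type*} (S : ℕ → OmegaData N M K) : ramIndex S 0 = 1 := by
  simp [ramIndex]

lemma ramIndex_succ {N M : ℕ} {K : Type*} (S : ℕ → OmegaData N M K) (i : ℕ) :
    ramIndex S (i + 1) * (S i).d = ramIndex S i := by
  have h : ((S i).d : ℚ) ≠ 0 := Nat.cast_ne_zero.2 (S i).d_pos.ne'
  rw [ramIndex, ramIndex, Finset.prod_range_succ, one_div, one_div, mul_inv, mul_assoc,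
    inv_mul_cancel₀ h, mul_one]

/-- The exponent of the `i`-th term of the `j`-th series defined by a sequence. -/
def serExponent (S : ℕ → OmegaData N M K) (i : ℕ) (j : Fin M) : Fin N → ℚ :=
  ramIndex S i • (S i).exponent j

/-- The partial sums of the series defined by a sequence. -/
def partialSer (S : ℕ → OmegaData N M K) (i : ℕ) (j : Fin M) : FracRing N K :=
  ∑ k ∈ Finset.range i, (S k).term (ramIndex S k) j

lemma partialSer_succ (S : ℕ → OmegaData N M K) (i : ℕ) (j : Fin M) :
    partialSer S (i + 1) j = partialSer S i j + (S i).term (ramIndex S i) j :=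
  Finset.sum_range_succ _ _

/-- The substitutions telescope: each adds its monomials to `y`, and the factors `d` undo the
denominators in `ramIndex`. The target `R` is left free in order to cover both polynomial and series
values. -/
lemma eval₂_polySeq {R : Type*} [CommRing R] (S : ℕ → OmegaData N M K)
    (g : FracRing N K →+* R) (f : MixedRing N M K) (i : ℕ) (y : Fin M → R) :
    eval₂ (g.comp (fracEmb N K (ramIndex S i))) y (polySeq S f i) =
      eval₂ (g.comp (fracEmb N K 1)) (fun j => y j + g (partialSer S i j)) f := by
  induction i generalizing y with
  | zero => simp [polySeq, partialSer, ramIndex_zero]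
  | succ i ih =>
    rw [polySeq, OmegaData.eval₂_subst, ramIndex_succ, ih]
    congr 1
    funext j
    rw [partialSer_succ, map_add]
    ring

/-- The polynomial `f(x, y + p)`, where `p` is the tuple of the `i`-th partial sums. -/
def shiftedPoly (S : ℕ → OmegaData N M K) (f : MixedRing N M K) (i : ℕ) :
    MvPolynomial (Fin M) (FracRing N K) :=
  eval₂ (C.comp (fracEmb N K 1)) (fun j => X j + C (partialSer S i j)) f

lemma map_polySeq (S : ℕ → OmegaData N M K) (f : MixedRing N M K) (i : ℕ) :
    MvPolynomial.map (fracEmb N K (ramIndex S i)) (polySeq S f i) = shiftedPoly S f i := by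
  rw [shiftedPoly, ← eval₂_polySeq S C f i X, map_eq_eval₂Hom_C_comp, coe_eval₂Hom]

lemma coeff_fracEmb_scaleHom {r : ℚ} (hr : r ≠ 0) (a : LaurentRing N K) (α : Fin N → ℤ) :
    (fracEmb N K r a).coeff (scaleHom N r α) = a.coeff α := by
  have h : Function.Injective (scaleHom N r) := fun a b h => funext fun l => by
    have := congrFun h l
    simpa [scaleHom, hr] using this
  exact Finsupp.mapDomain_apply h _ _

/-- A finite weight rules out every variable of infinite order. -/
lemma IsOmegaSet.of_mixedWeight_eq (hω : LinearIndependent ℚ ω) {D : OmegaData N M K}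
    (hD : IsOmegaSet ω D) {α : Fin N → ℤ} {β : Fin M →₀ ℕ} {v : ℝ}
    (h : mixedWeight ω D.η α β = (v : WithTop ℝ)) :
    (∀ j, D.η j = ⊤ → β j = 0) ∧ v = omegaHom ω (D.totalExponent α β) := by
  have h1 : ∀ j, D.η j = ⊤ → β j = 0 := by
    intro j hj
    by_contra h0
    have h2 : mixedWeight ω D.η α β = ⊤ := by
      rw [mixedWeight, WithTop.add_eq_top]
      refine Or.inr (WithTop.sum_eq_top.2 ⟨j, Finset.mem_univ j, ?_⟩)
      rw [hj]
      exact WithTop.top_mul (by exact_mod_cast h0)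
    rw [h] at h2
    exact WithTop.coe_ne_top h2
  refine ⟨h1, ?_⟩
  rw [hD.mixedWeight_eq hω α, WithTop.coe_eq_coe] at h
  · exact h.symm
  · refine Finset.prod_ne_zero_iff.2 fun j _ => ?_
    by_cases hj : D.η j = ⊤
    · rw [h1 j hj, pow_zero]
      exact one_ne_zero
    · exact pow_ne_zero _ ((hD.2.2 j).2 hj)

/-- Each term of an `ω`-sequence cancels initial parts, in the original variables. -/
lemma IsOmegaSequence.exists_lt (hω : LinearIndependent ℚ ω) {I : Ideal (MixedRing N M K)} {L : ℕ∞}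
    {S : ℕ → OmegaData N M K} (hS : IsOmegaSequence ω I L S) {i : ℕ} (hi : (i : ℕ∞) ≤ L)
    {f : MixedRing N M K} (hf : f ∈ I) {γ : Fin N → ℚ}
    (hγ : (eval₂ (fracEmb N K 1) (partialSer S (i + 1)) f).coeff γ ≠ 0) :
    ∃ β α, (coeff β (shiftedPoly S f i)).coeff α ≠ 0 ∧ (∀ j, (S i).η j = ⊤ → β j = 0) ∧
      omegaHom ω (α + ∑ j, β j • serExponent S i j) < omegaHom ω γ := by
  have h1 : eval₂ (fracEmb N K (ramIndex S i)) ((S i).term (ramIndex S i)) (polySeq S f i) =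
      eval₂ (fracEmb N K 1) (partialSer S (i + 1)) f := by
    have := eval₂_polySeq S (RingHom.id _) f i ((S i).term (ramIndex S i))
    simp only [RingHom.id_comp, RingHom.id_apply] at this
    rw [this]
    congr 1
    funext j
    rw [partialSer_succ, add_comm]
  rw [← h1] at hγ
  have hr := ramIndex_pos S i
  obtain ⟨β, α, h2, v, hv, hlt⟩ :=
    (hS.1 i hi).cancelsInitial hω hr (polySeq_mem S hf i) γ hγ
  obtain ⟨h3, rfl⟩ := (hS.1 i hi).1.of_mixedWeight_eq hω hv
  refine ⟨β, scaleHom N (ramIndex S i) α, ?_, h3, ?_⟩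
  · rwa [← map_polySeq, coeff_map, coeff_fracEmb_scaleHom hr.ne']
  · rw [← omegaHom_smul, OmegaData.totalExponent, smul_add, Finset.smul_sum] at hlt
    simp only [serExponent, smul_comm _ (ramIndex S i)]
    exact hlt

/-- Nothing exceeds `d · ∞ = ∞`, so a coordinate that has become zero stays zero. -/
lemma IsOmegaSequence.eta_ne_top {I : Ideal (MixedRing N M K)} {L : ℕ∞}
    {S : ℕ → OmegaData N M K} (hS : IsOmegaSequence ω I L S) {i : ℕ}
    (hi : ((i + 1 : ℕ) : ℕ∞) ≤ L) {j : Fin M} (hj : (S (i + 1)).η j ≠ ⊤) : (S i).η j ≠ ⊤ := by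
  intro h
  have := hS.2 i hi j hj
  rw [h, WithTop.mul_top (by exact_mod_cast (S i).d_pos.ne')] at this
  exact not_top_lt this

lemma IsOmegaSequence.omegaHom_lt_succ (hω : LinearIndependent ℚ ω) {I : Ideal (MixedRing N M K)}
    {L : ℕ∞} {S : ℕ → OmegaData N M K} (hS : IsOmegaSequence ω I L S) {i : ℕ}
    (hi : ((i + 1 : ℕ) : ℕ∞) ≤ L) {j : Fin M} (hj : (S (i + 1)).η j ≠ ⊤) :
    omegaHom ω (serExponent S i j) < omegaHom ω (serExponent S (i + 1) j) := by
  have hi' : (i : ℕ∞) ≤ L := le_trans (by exact_mod_cast Nat.le_succ i) hi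
  have h := hS.2 i hi j hj
  rw [(hS.1 i hi').1.eta_eq hω (hS.eta_ne_top hi hj), (hS.1 _ hi).1.eta_eq hω hj,
    ← WithTop.coe_mul, WithTop.coe_lt_coe] at h
  have hr : (0 : ℝ) < ramIndex S (i + 1) := by exact_mod_cast ramIndex_pos S (i + 1)
  -- The growth condition on `η` multiplied by `r⁽ⁱ⁺¹⁾`, since `r⁽ⁱ⁺¹⁾ d = r⁽ⁱ⁾`.
  rw [serExponent, serExponent, omegaHom_smul, omegaHom_smul, ← ramIndex_succ]
  push_cast
  rw [mul_assoc]
  exact mul_lt_mul_of_pos_left h hr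

lemma IsOmegaSequence.omegaHom_lt (hω : LinearIndependent ℚ ω) {I : Ideal (MixedRing N M K)}
    {L : ℕ∞} {S : ℕ → OmegaData N M K} (hS : IsOmegaSequence ω I L S) {i k : ℕ} (hik : i < k)
    (hk : (k : ℕ∞) ≤ L) {j : Fin M} (hj : (S k).η j ≠ ⊤) :
    (S i).η j ≠ ⊤ ∧ omegaHom ω (serExponent S i j) < omegaHom ω (serExponent S k j) := by
  induction k, hik using Nat.le_induction with
  | base => exact ⟨hS.eta_ne_top hk hj, hS.omegaHom_lt_succ hω hk hj⟩
  | succ k hik ih =>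
    have hk' : (k : ℕ∞) ≤ L := le_trans (by exact_mod_cast Nat.le_succ k) hk
    obtain ⟨h1, h2⟩ := ih hk' (hS.eta_ne_top hk hj)
    exact ⟨h1, h2.trans (hS.omegaHom_lt_succ hω hk hj)⟩

lemma coeff_monomials_ne_zero_iff (S : ℕ → OmegaData N M K) (i : ℕ) (j : Fin M)
    (γ : OmegaExp ω) : ((S i).monomials ω (ramIndex S i) j).1.coeff γ ≠ 0 ↔
      (S i).c j ≠ 0 ∧ γ = toExp ω (serExponent S i j) := by
  change (HahnSeries.single (toExp ω (serExponent S i j)) ((S i).c j)).coeff γ ≠ 0 ↔ _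
  by_cases h : γ = toExp ω (serExponent S i j)
  · subst h
    simp
  · simp [HahnSeries.coeff_single_of_ne h, h]

lemma IsOmegaSequence.contributors_subsingleton (hω : LinearIndependent ℚ ω)
    {I : Ideal (MixedRing N M K)} {L : ℕ∞} {S : ℕ → OmegaData N M K}
    (hS : IsOmegaSequence ω I L S) (j : Fin M) (γ : OmegaExp ω) :
    (contributors ω L S j γ).Subsingleton := by
  have key : ∀ i k, i < k → i ∈ contributors ω L S j γ → k ∉ contributors ω L S j γ := by
    rintro i k hik ⟨-, hi⟩ ⟨hkL, hk⟩
    rw [coeff_monomials_ne_zero_iff] at hi hk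
    have h := (hS.omegaHom_lt hω hik hkL (((hS.1 k hkL).1.2.2 j).1 hk.1)).2
    have : serExponent S i j = serExponent S k j := hi.2.symm.trans hk.2
    rw [this] at h
    exact lt_irrefl _ h
  intro i hi k hk
  rcases lt_trichotomy i k with h | h | h
  · exact absurd hk (key i k h hi)
  · exact h
  · exact absurd hi (key k i h hk)

end Sequence

/-! ### Supports of the series defined by an `ω`-sequence -/

section SeriesSupport

variable {N M : ℕ} {K : Type*} [Field K] {ω : Fin N → ℝ}

lemma Set.Finite.isOmegaPuiseuxSupport (ω : Fin N → ℝ) {E : Set (Fin N → ℚ)} (hE : E.Finite) :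
    IsOmegaPuiseuxSupport ω E := by
  induction E, hE using Set.Finite.induction_on with
  | empty => exact (isOmegaPuiseuxSupport_singleton ω 0).mono (Set.empty_subset _)
  | insert _ _ ih => exact (isOmegaPuiseuxSupport_singleton ω _).union ih

/-- A common denominator of the generators serves the whole monoid, and the cone they span is
`ω`-positive. -/
lemma isOmegaPuiseuxSupport_closure {T : Finset (Fin N → ℚ)} (hT : ∀ t ∈ T, 0 ≤ omegaHom ω t) :
    IsOmegaPuiseuxSupport ω (AddSubmonoid.closure (T : Set (Fin N → ℚ)) : Set (Fin N → ℚ)) := by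
  obtain ⟨⟨k, hk, h1⟩, -⟩ := Set.Finite.isOmegaPuiseuxSupport ω T.finite_toSet
  refine ⟨⟨k, hk, fun t ht => ?_⟩, 0, PointedCone.hull ℝ (realVec '' (T : Set (Fin N → ℚ))),
    ⟨T, rfl⟩, fun v hv => ?_, fun t ht => ?_⟩
  · induction ht using AddSubmonoid.closure_induction with
    | mem t ht => exact h1 t ht
    | zero => exact fun l => ⟨0, by simp⟩
    | add a b _ _ ha hb =>
      intro l
      obtain ⟨z, hz⟩ := ha l
      obtain ⟨y, hy⟩ := hb l
      exact ⟨z + y, by rw [Pi.add_apply, hz, hy]; push_cast; ring⟩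
  · induction hv using Submodule.span_induction with
    | mem v hv =>
      obtain ⟨t, ht, rfl⟩ := hv
      exact hT t ht
    | zero => simp
    | add u v _ _ hu hv =>
      simp only [Pi.add_apply, mul_add, Finset.sum_add_distrib]
      exact add_nonneg hu hv
    | smul a v _ hv =>
      have : ∑ l, ω l * (a • v) l = (a : ℝ) * ∑ l, ω l * v l := by
        rw [Finset.mul_sum]
        refine Finset.sum_congr rfl fun l _ => ?_
        change ω l * ((a : ℝ) * v l) = _
        ring
      rw [this]
      exact mul_nonneg a.2 hv
  · rw [zero_add]
    induction ht using AddSubmonoid.closure_induction with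
    | mem t ht => exact Submodule.subset_span ⟨t, ht, rfl⟩
    | zero =>
      have : realVec (0 : Fin N → ℚ) = 0 := by ext; simp [realVec]
      rw [this]
      exact zero_mem _
    | add a b _ _ ha hb =>
      rw [realVec_add]
      exact add_mem ha hb

lemma coeff_aeval_X (j : Fin M) {R : Type*} [CommRing R] (Q : Polynomial R) (β : Fin M →₀ ℕ) :
    coeff β (Polynomial.aeval (X j : MvPolynomial (Fin M) R) Q) =
      if β = Finsupp.single j (β j) then Q.coeff (β j) else 0 := by
  classical
  induction Q using Polynomial.induction_on' with
  | add P Q hP hQ =>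
    rw [map_add, coeff_add, hP, hQ]
    split_ifs <;> simp
  | monomial k a =>
    have : Polynomial.aeval (X j : MvPolynomial (Fin M) R) (Polynomial.monomial k a) =
        monomial (Finsupp.single j k) a := by
      rw [Polynomial.aeval_monomial, algebraMap_eq, C_mul_X_pow_eq_monomial]
    rw [this, coeff_monomial, Polynomial.coeff_monomial]
    by_cases h : Finsupp.single j k = β
    · subst h
      simp
    · rw [if_neg h]
      split_ifs with h1 h2
      · exact absurd (by rw [h1, h2]) h
      all_goals rfl

lemma eval₂_aeval_X {R T : Type*} [CommRing R] [CommRing T] (g : R →+* T) (j : Fin M)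
    (y : Fin M → T) (Q : Polynomial R) :
    eval₂ g y (Polynomial.aeval (X j : MvPolynomial (Fin M) R) Q) = Q.eval₂ g (y j) := by
  have : (eval₂Hom g y).comp (Polynomial.aeval (X j : MvPolynomial (Fin M) R)).toRingHom =
      Polynomial.eval₂RingHom g (y j) := by
    refine Polynomial.ringHom_ext (fun a => ?_) ?_
    · simp
    · simp
  exact RingHom.congr_fun this Q

/-- For a polynomial in `y_j` alone, the shifted polynomials are one-variable Taylor shifts, so
cancellation along the sequence is the hypothesis `H` of `exists_exponents_mem_closure`. -/
lemma IsOmegaSequence.isOmegaPuiseuxSupport_range [CharZero K] (hω : LinearIndependent ℚ ω)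
    {I : Ideal (MixedRing N M K)} {S : ℕ → OmegaData N M K} (hS : IsOmegaSequence ω I ⊤ S)
    {j : Fin M} (hj : ∀ i, (S i).η j ≠ ⊤) {G : Polynomial (LaurentRing N K)} (hG : G ≠ 0)
    (hGI : Polynomial.aeval (X j : MixedRing N M K) G ∈ I) :
    IsOmegaPuiseuxSupport ω (Set.range fun i => serExponent S i j) := by
  set F := G.map (fracEmb N K 1) with hF
  have hshift : ∀ i, shiftedPoly S (Polynomial.aeval (X j : MixedRing N M K) G) i =
      Polynomial.aeval (X j) (Polynomial.taylor (partialSer S i j) F) := by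
    intro i
    rw [shiftedPoly, eval₂_aeval_X, Polynomial.taylor_apply, Polynomial.aeval_def,
      Polynomial.eval₂_comp, hF, Polynomial.eval₂_map, algebraMap_eq]
    simp
  obtain ⟨s, T, hT, h⟩ := exists_exponents_mem_closure (omegaHom ω) (omegaHom_injective hω)
    ((Polynomial.map_ne_zero_iff (fracEmb_injective one_ne_zero)).2 hG : F ≠ 0)
    (fun i => serExponent S i j) (fun i => (S i).c j)
    (fun i => ((hS.1 i le_top).1.2.2 j).2 (hj i))
    (fun i => hS.omegaHom_lt_succ hω le_top (hj _)) (fun i => partialSer S i j)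
    (fun i => partialSer_succ S i j) (by
      intro i γ hγ
      rw [Polynomial.eval_map, ← eval₂_aeval_X] at hγ
      obtain ⟨β, α, h1, -, h2⟩ := hS.exists_lt hω le_top hGI hγ
      rw [hshift, coeff_aeval_X] at h1
      split_ifs at h1 with hβ
      · refine ⟨β j, α, h1, ?_⟩
        rw [hβ, Finset.sum_eq_single j] at h2
        · simpa using h2
        · intro k _ hk
          rw [Finsupp.single_eq_of_ne hk, zero_nsmul]
        · simp
      · exact absurd rfl h1)
  refine (Set.Finite.isOmegaPuiseuxSupport ω ((Set.finite_lt_nat s).image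
    fun i => serExponent S i j)).union ((isOmegaPuiseuxSupport_singleton ω (serExponent S s j)).add
    (isOmegaPuiseuxSupport_closure hT) (G := (fun i => serExponent S i j) '' {i | s ≤ i}) ?_)
    |>.mono ?_
  · rintro _ ⟨i, hi, rfl⟩
    exact ⟨_, rfl, _, h i hi, add_sub_cancel _ _⟩
  · rintro _ ⟨i, rfl⟩
    rcases lt_or_ge i s with hi | hi
    · exact Or.inl ⟨i, hi, rfl⟩
    · exact Or.inr ⟨i, hi, rfl⟩

/-- An `ω`-sequence of an admissible ideal defines a tuple of `ω`-positive Puiseux series. -/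
theorem IsOmegaSequence.exists_isSeriesOf [IsAlgClosed K] [CharZero K]
    (hω : LinearIndependent ℚ ω) {I : Ideal (MixedRing N M K)} (hI : IsLaurentAdmissible I)
    {L : ℕ∞} {S : ℕ → OmegaData N M K} (hS : IsOmegaSequence ω I L S) :
    ∃ φ : Fin M → OmegaPuiseux K ω, IsSeriesOf ω L S φ := by
  have hsupp : ∀ j, IsOmegaPuiseuxSupport ω
      {γ : Fin N → ℚ | (contributors ω L S j (toExp ω γ)).Nonempty} := by
    intro j
    -- Either only finitely many terms of the coordinate are nonzero, or `L = ∞` and, since a zero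
    -- coordinate stays zero, every term is nonzero.
    by_cases hfin : ∃ n : ℕ, ∀ i : ℕ, (i : ℕ∞) ≤ L → (S i).c j ≠ 0 → i < n
    · obtain ⟨n, hn⟩ := hfin
      refine (Set.Finite.isOmegaPuiseuxSupport ω ((Set.finite_lt_nat n).image
        fun i => serExponent S i j)).mono ?_
      rintro γ ⟨i, hi, h⟩
      rw [coeff_monomials_ne_zero_iff] at h
      exact ⟨i, hn i hi h.1, h.2.symm⟩
    · push Not at hfin
      obtain rfl : L = ⊤ := by
        by_contra hL
        obtain ⟨l, rfl⟩ := ENat.ne_top_iff_exists.1 hL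
        obtain ⟨i, hi, -, h⟩ := hfin (l + 1)
        have : i ≤ l := by exact_mod_cast hi
        omega
      obtain ⟨G, hG, hGI⟩ := hI.exists_aeval_mem j
      refine (hS.isOmegaPuiseuxSupport_range hω (j := j) (fun i => ?_) hG hGI).mono ?_
      · obtain ⟨k, hk, hc, hik⟩ := hfin (i + 1)
        exact (hS.omegaHom_lt hω hik hk (((hS.1 k hk).1.2.2 j).1 hc)).1
      · rintro γ ⟨i, -, h⟩
        rw [coeff_monomials_ne_zero_iff] at h
        exact ⟨i, h.2.symm⟩
  have hzero : ∀ j (γ : OmegaExp ω), serCoeff ω L S j γ ≠ 0 →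
      (contributors ω L S j γ).Nonempty := by
    intro j γ h
    by_contra h0
    rw [Set.not_nonempty_iff_eq_empty] at h0
    exact h (by rw [serCoeff, h0]; simp)
  refine ⟨fun j => ⟨⟨serCoeff ω L S j, ((hsupp j).mono ?_).isPWO hω⟩, (hsupp j).mono ?_⟩,
    fun j γ => ⟨(hS.contributors_subsingleton hω j γ).finite, rfl⟩⟩
  · exact fun γ h => hzero j γ h
  · exact fun γ h => hzero j _ h

end SeriesSupport

/-! ### Finiteness of the exponents of bounded weight. -/

/-- The exponents of bounded weight in the support of an `ω`-positive Puiseux series are finitely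
many. -/
lemma IsOmegaPuiseuxSupport.finite_omegaDot_le {N : ℕ} {ω : Fin N → ℝ}
    (hω : LinearIndependent ℚ ω) {E : Set (OmegaExp ω)} (hE : IsOmegaPuiseuxSupport ω E) (t : ℝ) :
    {a ∈ E | omegaDot ω a ≤ t}.Finite := by
  classical
  have hinj : ∀ a : Fin N → ℚ, omegaDot ω a = 0 → a = 0 := fun a ha =>
    omegaHom_injective hω (ha.trans (map_zero (omegaHom ω)).symm)
  obtain ⟨⟨k, hk, h1⟩, γ, σ, ⟨s, rfl⟩, hp, h2⟩ := hE
  have hkr : (0 : ℝ) < k := by exact_mod_cast hk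
  -- On the cone the weight controls all coordinates: a rational generator of weight zero is itself
  -- zero by rational independence, and the others contribute ratios `|w l| / (ω · w)`. Bounded
  -- weight thus leaves finitely many points of the lattice.
  obtain ⟨C, hC⟩ : ∃ C : ℝ, ∀ v ∈ PointedCone.hull ℝ (realVec '' (s : Set (Fin N → ℚ))), ∀ l,
      |v l| ≤ C * ∑ i, ω i * v i := by
    have hpos : ∀ w ∈ s, 0 ≤ omegaDot ω w := fun w hw =>
      hp _ (Submodule.subset_span ⟨w, hw, rfl⟩)
    refine ⟨∑ w ∈ s, ∑ l, |(w l : ℝ)| / omegaDot ω w, fun v hv l => ?_⟩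
    induction hv using Submodule.span_induction with
    | mem v hv =>
      obtain ⟨w, hw, rfl⟩ := hv
      change |(w l : ℝ)| ≤ _ * omegaDot ω w
      rcases (hpos w hw).eq_or_lt with h | h
      · have := hinj w h.symm
        subst this
        simp [omegaDot]
      · have hle : |(w l : ℝ)| / omegaDot ω w ≤ ∑ w ∈ s, ∑ l, |(w l : ℝ)| / omegaDot ω w := by
          refine le_trans ?_ (Finset.single_le_sum (f := fun w => ∑ l, |(w l : ℝ)| / omegaDot ω w)
            (fun u hu => Finset.sum_nonneg fun i _ => div_nonneg (abs_nonneg _) (hpos u hu)) hw)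
          exact Finset.single_le_sum (f := fun l => |(w l : ℝ)| / omegaDot ω w)
            (fun i _ => div_nonneg (abs_nonneg _) (hpos w hw)) (Finset.mem_univ l)
        exact (div_le_iff₀ h).1 hle
    | zero => simp
    | add u v _ _ hu hv =>
      simp only [Pi.add_apply, mul_add, Finset.sum_add_distrib]
      exact (abs_add_le _ _).trans (by simpa [mul_add] using add_le_add hu hv)
    | smul a v _ hv =>
      have e : ∑ i, ω i * (a • v) i = (a : ℝ) * ∑ i, ω i * v i := by
        rw [Finset.mul_sum]
        refine Finset.sum_congr rfl fun i _ => ?_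
        change ω i * ((a : ℝ) * v i) = _
        ring
      have e' : (a • v) l = (a : ℝ) * v l := rfl
      have ha : (0 : ℝ) ≤ a := a.2
      rw [e, e', abs_mul, abs_of_nonneg ha]
      nlinarith [mul_le_mul_of_nonneg_left hv ha]
  obtain ⟨B, hB⟩ : ∃ B : ℕ, ∀ a ∈ E, omegaDot ω a ≤ t → ∀ l, |(a l : ℝ)| * k ≤ B := by
    obtain ⟨B, hB⟩ := exists_nat_ge
      ((|C| * (omegaDot ω γ + t) + ∑ i, |(γ i : ℝ)|) * k)
    refine ⟨B, fun a ha hat l => le_trans (mul_le_mul_of_nonneg_right ?_ hkr.le) hB⟩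
    have h2' := h2 a ha
    change realVec (toExp ω γ + a) ∈ _ at h2'
    have h := hC _ h2' l
    have h0 := hp _ h2'
    have e : ∑ i, ω i * realVec (toExp ω γ + a) i = omegaDot ω γ + omegaDot ω a :=
      omegaDot_add ω γ a
    rw [e] at h h0
    have e2 : realVec (toExp ω γ + a) l = (γ l : ℝ) + (a l : ℝ) := by
      change (((γ l + a l : ℚ)) : ℝ) = _
      push_cast; rfl
    rw [e2] at h
    have h3 : |(γ l : ℝ)| ≤ ∑ i, |(γ i : ℝ)| :=
      Finset.single_le_sum (f := fun i => |(γ i : ℝ)|) (fun i _ => abs_nonneg _)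
        (Finset.mem_univ l)
    have h4 : |(a l : ℝ)| ≤ |(γ l : ℝ) + (a l : ℝ)| + |(γ l : ℝ)| := by
      have := abs_sub ((γ l : ℝ) + (a l : ℝ)) (γ l : ℝ)
      simpa using this
    have h5 : C * (omegaDot ω γ + omegaDot ω a) ≤ |C| * (omegaDot ω γ + t) :=
      (mul_le_mul_of_nonneg_right (le_abs_self C) h0).trans
        (mul_le_mul_of_nonneg_left (by linarith) (abs_nonneg C))
    linarith
  refine ((Set.Finite.pi' (fun _ : Fin N => Set.finite_Icc (-(B : ℤ)) B)).image
    (fun z l => (z l : ℚ) / (k : ℚ))).subset ?_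
  rintro a ⟨ha, hat⟩
  choose z hz using h1 a ha
  refine ⟨z, fun l => ?_, funext fun l => (hz l).symm⟩
  have h := hB a ha hat l
  rw [hz l] at h
  push_cast at h
  rw [abs_div, abs_of_pos hkr, div_mul_cancel₀ _ hkr.ne'] at h
  have h' : |z l| ≤ (B : ℤ) := by exact_mod_cast h
  exact abs_le.1 h'

/-! ### Weights of Hahn series -/

section Weights

variable {N M : ℕ} {K : Type*} [Field K] {ω : Fin N → ℝ}

/-- All the exponents of `a` have weight at least `t`. -/
def WeightGE (t : ℝ) (a : HahnSeries (OmegaExp ω) K) : Prop :=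
  ∀ γ, a.coeff γ ≠ 0 → t ≤ omegaHom ω γ

lemma weightGE_zero (t : ℝ) : WeightGE t (0 : HahnSeries (OmegaExp ω) K) :=
  fun _ h => absurd rfl h

lemma weightGE_one : WeightGE 0 (1 : HahnSeries (OmegaExp ω) K) := by
  intro γ h
  have : γ = 0 := by
    by_contra h0
    exact h (HahnSeries.coeff_single_of_ne h0)
  rw [this]
  exact (map_zero (omegaHom ω)).ge

lemma weightGE_single (α : Fin N → ℚ) (c : K) :
    WeightGE (omegaHom ω α) (HahnSeries.single (toExp ω α) c) := by
  intro γ h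
  have : γ = toExp ω α := by
    by_contra h0
    exact h (HahnSeries.coeff_single_of_ne h0)
  rw [this]
  exact le_rfl

lemma WeightGE.mono {s t : ℝ} {a : HahnSeries (OmegaExp ω) K} (ha : WeightGE t a) (h : s ≤ t) :
    WeightGE s a := fun γ hγ => h.trans (ha γ hγ)

lemma WeightGE.add {t : ℝ} {a b : HahnSeries (OmegaExp ω) K} (ha : WeightGE t a)
    (hb : WeightGE t b) : WeightGE t (a + b) := by
  intro γ h
  by_cases h0 : a.coeff γ = 0
  · refine hb γ fun h1 => h ?_
    rw [HahnSeries.coeff_add, h0, h1, add_zero]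
  · exact ha γ h0

lemma HahnSeries.exists_of_coeff_mul_ne_zero {a b : HahnSeries (OmegaExp ω) K} {γ : OmegaExp ω}
    (h : (a * b).coeff γ ≠ 0) : ∃ α β, a.coeff α ≠ 0 ∧ b.coeff β ≠ 0 ∧ α + β = γ := by
  obtain ⟨α, hα, β, hβ, hab⟩ := HahnSeries.support_mul_subset h
  exact ⟨α, β, hα, hβ, hab⟩

lemma omegaHom_add (α β : OmegaExp ω) :
    omegaHom ω (α + β : OmegaExp ω) = omegaHom ω α + omegaHom ω β :=
  omegaDot_add ω α β

lemma WeightGE.mul {s t : ℝ} {a b : HahnSeries (OmegaExp ω) K} (ha : WeightGE s a)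
    (hb : WeightGE t b) : WeightGE (s + t) (a * b) := by
  intro γ h
  obtain ⟨α, β, hα, hβ, rfl⟩ := HahnSeries.exists_of_coeff_mul_ne_zero h
  exact (add_le_add (ha α hα) (hb β hβ)).trans (omegaHom_add α β).ge

/-- The gain `ε` passes to products through `u U - v V = (u - v) U + v (U - V)`; the two bounds on
the products are carried along to make the induction close. -/
lemma weightGE_prod_sub_prod {ι : Type*} (s : Finset ι) {u v : ι → HahnSeries (OmegaExp ω) K}
    {t : ι → ℝ} {ε : ℝ} (hu : ∀ i ∈ s, WeightGE (t i) (u i)) (hv : ∀ i ∈ s, WeightGE (t i) (v i))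
    (huv : ∀ i ∈ s, WeightGE (t i + ε) (u i - v i)) :
    WeightGE (∑ i ∈ s, t i) (∏ i ∈ s, u i) ∧ WeightGE (∑ i ∈ s, t i) (∏ i ∈ s, v i) ∧
      WeightGE (∑ i ∈ s, t i + ε) (∏ i ∈ s, u i - ∏ i ∈ s, v i) := by
  classical
  induction s using Finset.induction_on with
  | empty =>
    refine ⟨weightGE_one, weightGE_one, ?_⟩
    rw [Finset.prod_empty, Finset.prod_empty, sub_self]
    exact weightGE_zero _
  | insert a s ha ih =>
    obtain ⟨h1, h2, h3⟩ := ih (fun i hi => hu i (Finset.mem_insert_of_mem hi))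
      (fun i hi => hv i (Finset.mem_insert_of_mem hi))
      (fun i hi => huv i (Finset.mem_insert_of_mem hi))
    have ha' := Finset.mem_insert_self a s
    simp only [Finset.sum_insert ha, Finset.prod_insert ha]
    refine ⟨(hu a ha').mul h1, (hv a ha').mul h2, ?_⟩
    have : u a * ∏ i ∈ s, u i - v a * ∏ i ∈ s, v i =
        (u a - v a) * ∏ i ∈ s, u i + v a * (∏ i ∈ s, u i - ∏ i ∈ s, v i) := by ring
    rw [this]
    exact (((huv a ha').mul h1).mono (by linarith)).add (((hv a ha').mul h3).mono (by linarith))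

lemma weightGE_prod_pow_sub_prod_pow {u v : Fin M → HahnSeries (OmegaExp ω) K}
    {t : Fin M → ℝ} {ε : ℝ} (hu : ∀ i, WeightGE (t i) (u i)) (hv : ∀ i, WeightGE (t i) (v i))
    (huv : ∀ i, WeightGE (t i + ε) (u i - v i)) (β : Fin M →₀ ℕ) :
    WeightGE (∑ i, β i * t i + ε) (∏ i, u i ^ β i - ∏ i, v i ^ β i) := by
  have key : ∀ i, WeightGE (β i * t i) (u i ^ β i) ∧ WeightGE (β i * t i) (v i ^ β i) ∧
      WeightGE (β i * t i + ε) (u i ^ β i - v i ^ β i) := by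
    intro i
    simpa using weightGE_prod_sub_prod (Finset.range (β i)) (fun _ _ => hu i) (fun _ _ => hv i)
      (fun _ _ => huv i)
  exact (weightGE_prod_sub_prod Finset.univ (fun i _ => (key i).1) (fun i _ => (key i).2.1)
    (fun i _ => (key i).2.2)).2.2

lemma HahnSeries.smul_single_one (α : OmegaExp ω) (c : K) :
    c • HahnSeries.single α (1 : K) = HahnSeries.single α c := by
  classical
  ext γ
  rw [HahnSeries.coeff_smul, HahnSeries.coeff_single, HahnSeries.coeff_single]
  split_ifs <;> simp

/-- The inclusion of the fractional Laurent polynomials in the Hahn series. -/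
def fracToHahn (K : Type*) [Field K] (ω : Fin N → ℝ) :
    FracRing N K →+* HahnSeries (OmegaExp ω) K :=
  (AddMonoidAlgebra.lift K (HahnSeries (OmegaExp ω) K) (Fin N → ℚ)
    { toFun := fun α => HahnSeries.single (toExp ω α.toAdd) 1
      map_one' := rfl
      map_mul' := fun α β => by
        rw [HahnSeries.single_mul_single, one_mul]
        rfl }).toRingHom

lemma fracToHahn_single (α : Fin N → ℚ) (c : K) :
    fracToHahn K ω (AddMonoidAlgebra.single α c) = HahnSeries.single (toExp ω α) c := by
  change AddMonoidAlgebra.lift K _ (Fin N → ℚ) _ _ = _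
  rw [AddMonoidAlgebra.lift_single]
  change c • HahnSeries.single (toExp ω α) (1 : K) = _
  exact HahnSeries.smul_single_one _ _

lemma coeff_fracToHahn (a : FracRing N K) (γ : Fin N → ℚ) :
    (fracToHahn K ω a).coeff (toExp ω γ) = a.coeff γ := by
  classical
  induction a using AddMonoidAlgebra.induction_linear with
  | zero => simp
  | add a b ha hb => simp [ha, hb]
  | single α c =>
    rw [fracToHahn_single, HahnSeries.coeff_single, AddMonoidAlgebra.coeff_single,
      Finsupp.single_apply]
    exact if_congr eq_comm rfl rfl

/-- Comparison of the values of a polynomial at two tuples. -/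
lemma exists_of_coeff_eval₂_sub_ne_zero {r : ℚ} (f : MixedRing N M K)
    {u v : Fin M → HahnSeries (OmegaExp ω) K} {t : Fin M → ℝ} {ε : ℝ}
    (hu : ∀ i, WeightGE (t i) (u i)) (hv : ∀ i, WeightGE (t i) (v i))
    (huv : ∀ i, WeightGE (t i + ε) (u i - v i)) {γ : OmegaExp ω}
    (hγ : (eval₂ ((fracToHahn K ω).comp (fracEmb N K r)) u f -
      eval₂ ((fracToHahn K ω).comp (fracEmb N K r)) v f).coeff γ ≠ 0) :
    ∃ β α, (coeff β f).coeff α ≠ 0 ∧ (∀ j, u j = 0 → v j = 0 → β j = 0) ∧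
      omegaHom ω (scaleHom N r α) + ∑ j, β j * t j + ε ≤ omegaHom ω γ := by
  classical
  rw [eval₂_eq', eval₂_eq', ← Finset.sum_sub_distrib] at hγ
  simp only [← mul_sub] at hγ
  rw [HahnSeries.coeff_sum] at hγ
  obtain ⟨β, -, hβ⟩ := Finset.exists_ne_zero_of_sum_ne_zero hγ
  obtain ⟨α, γ', hα, hγ', rfl⟩ := HahnSeries.exists_of_coeff_mul_ne_zero hβ
  obtain ⟨α, hα', rfl⟩ : ∃ α', (coeff β f).coeff α' ≠ 0 ∧ scaleHom N r α' = α := by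
    have h1 : (fracEmb N K r (coeff β f)).coeff α ≠ 0 := by
      exact fun h0 => hα ((coeff_fracToHahn _ _).trans h0)
    obtain ⟨α', h2, h3⟩ := Finset.mem_image.1
      (Finsupp.mapDomain_support (Finsupp.mem_support_iff.2 h1))
    exact ⟨α', Finsupp.mem_support_iff.1 h2, h3⟩
  refine ⟨β, α, hα', fun j hj hj' => ?_, ?_⟩
  · by_contra h0
    have h1 : ∏ i, u i ^ β i = 0 :=
      Finset.prod_eq_zero (Finset.mem_univ j) (by rw [hj, zero_pow h0])
    have h2 : ∏ i, v i ^ β i = 0 :=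
      Finset.prod_eq_zero (Finset.mem_univ j) (by rw [hj', zero_pow h0])
    rw [h1, h2, sub_zero] at hγ'
    exact hγ' rfl
  · have := weightGE_prod_pow_sub_prod_pow hu hv huv β γ' hγ'
    refine le_trans ?_ (omegaHom_add (toExp ω (scaleHom N r α)) γ').ge
    rw [add_assoc]
    exact add_le_add_right this _

lemma laurentToPuiseux_val (a : LaurentRing N K) :
    (laurentToPuiseux K ω a).1 = fracToHahn K ω (fracEmb N K 1 a) := by
  induction a using AddMonoidAlgebra.induction_linear with
  | zero => simp
  | add a b ha hb => simp [ha, hb]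
  | single α c =>
    rw [laurentToPuiseux, AddMonoidAlgebra.lift_single, fracEmb_single, fracToHahn_single]
    change c • HahnSeries.single (toExp ω fun l => (α l : ℚ)) (1 : K) = _
    rw [HahnSeries.smul_single_one]
    congr 2
    simp [scaleHom]

/-- Since `S_ω` embeds in the Hahn series, the equations may be tested there, where partial sums and
tails are compared by weight. -/
lemma isOmegaSolution_iff (I : Ideal (MixedRing N M K)) (φ : Fin M → OmegaPuiseux K ω) :
    IsOmegaSolution ω I φ ↔ ∀ f ∈ I,
      eval₂ ((fracToHahn K ω).comp (fracEmb N K 1)) (fun j => (φ j).1) f = 0 := by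
  refine forall₂_congr fun f _ => ?_
  have h1 : ((OmegaPuiseux K ω).val : OmegaPuiseux K ω →+* HahnSeries (OmegaExp ω) K).comp
      (laurentToPuiseux K ω : LaurentRing N K →+* OmegaPuiseux K ω) =
      (fracToHahn K ω).comp (fracEmb N K 1) := RingHom.ext laurentToPuiseux_val
  have h2 := eval₂_comp_left
    ((OmegaPuiseux K ω).val : OmegaPuiseux K ω →+* HahnSeries (OmegaExp ω) K)
    (laurentToPuiseux K ω : LaurentRing N K →+* OmegaPuiseux K ω) φ f
  rw [h1] at h2
  change _ = eval₂ _ (fun j => (φ j).1) f at h2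
  rw [← h2]
  exact (map_eq_zero_iff _ Subtype.val_injective).symm

/-- A nonzero series has an exponent of least weight. -/
lemma HahnSeries.exists_omegaHom_le {a : HahnSeries (OmegaExp ω) K} (ha : a ≠ 0) :
    ∃ γ, a.coeff γ ≠ 0 ∧ WeightGE (omegaHom ω γ) a := by
  have hne := HahnSeries.support_nonempty_iff.2 ha
  refine ⟨a.isWF_support.min hne, a.isWF_support.min_mem hne, fun γ hγ => ?_⟩
  by_contra hlt
  rw [not_le] at hlt
  refine a.isWF_support.not_lt_min hne hγ (lt_of_le_of_ne (Or.inr hlt) fun h => ?_)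
  rw [← h] at hlt
  exact lt_irrefl _ hlt

end Weights

/-! ### Weights of shifted polynomials -/

section PolyWeights

variable {N M : ℕ} {K : Type*} [Field K] {ω : Fin N → ℝ}

/-- All the terms `x ^ α y ^ β` of `F` satisfy `ω · α + t · β ≥ δ`. -/
def PolyWeightGE (ω : Fin N → ℝ) (t : Fin M → ℝ) (δ : ℝ)
    (F : MvPolynomial (Fin M) (FracRing N K)) : Prop :=
  ∀ β α, (coeff β F).coeff α ≠ 0 → δ ≤ omegaHom ω α + ∑ j, β j * t j

lemma PolyWeightGE.mul {t : Fin M → ℝ} {δ ε : ℝ} {F G : MvPolynomial (Fin M) (FracRing N K)}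
    (hF : PolyWeightGE ω t δ F) (hG : PolyWeightGE ω t ε G) :
    PolyWeightGE ω t (δ + ε) (F * G) := by
  classical
  intro β α h
  rw [coeff_mul, AddMonoidAlgebra.coeff_sum, Finsupp.finsetSum_apply] at h
  obtain ⟨⟨b, b'⟩, hb, h1⟩ := Finset.exists_ne_zero_of_sum_ne_zero h
  obtain ⟨a, a', ha, ha', rfl⟩ := AddMonoidAlgebra.exists_of_coeff_mul_ne_zero h1
  obtain rfl := Finset.HasAntidiagonal.mem_antidiagonal.1 hb
  have h2 := hF _ _ ha
  have h3 := hG _ _ ha'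
  simp only [map_add, Finsupp.add_apply, Nat.cast_add, add_mul, Finset.sum_add_distrib]
  linarith

lemma polyWeightGE_one (t : Fin M → ℝ) :
    PolyWeightGE ω t 0 (1 : MvPolynomial (Fin M) (FracRing N K)) := by
  classical
  intro β α h
  rw [coeff_one] at h
  split_ifs at h with hβ
  · rw [AddMonoidAlgebra.one_def, AddMonoidAlgebra.coeff_single, Finsupp.single_apply] at h
    split_ifs at h with hα
    · simp [← hβ, ← hα]
    · exact absurd rfl h
  · exact absurd rfl h

lemma PolyWeightGE.prod {ι : Type*} (s : Finset ι) {t : Fin M → ℝ} {δ : ι → ℝ}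
    {F : ι → MvPolynomial (Fin M) (FracRing N K)} (hF : ∀ i ∈ s, PolyWeightGE ω t (δ i) (F i)) :
    PolyWeightGE ω t (∑ i ∈ s, δ i) (∏ i ∈ s, F i) := by
  classical
  induction s using Finset.induction_on with
  | empty => exact polyWeightGE_one t
  | insert a s ha ih =>
    rw [Finset.sum_insert ha, Finset.prod_insert ha]
    exact (hF a (Finset.mem_insert_self a s)).mul
      (ih fun i hi => hF i (Finset.mem_insert_of_mem hi))

lemma PolyWeightGE.sum {ι : Type*} (s : Finset ι) {t : Fin M → ℝ} {δ : ℝ}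
    {F : ι → MvPolynomial (Fin M) (FracRing N K)} (hF : ∀ i ∈ s, PolyWeightGE ω t δ (F i)) :
    PolyWeightGE ω t δ (∑ i ∈ s, F i) := by
  intro β α h
  rw [coeff_sum, AddMonoidAlgebra.coeff_sum, Finsupp.finsetSum_apply] at h
  obtain ⟨i, hi, h1⟩ := Finset.exists_ne_zero_of_sum_ne_zero h
  exact hF i hi β α h1

lemma polyWeightGE_C {t : Fin M → ℝ} {δ : ℝ} {a : FracRing N K}
    (ha : ∀ α, a.coeff α ≠ 0 → δ ≤ omegaHom ω α) : PolyWeightGE ω t δ (C a) := by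
  classical
  intro β α h
  rw [coeff_C] at h
  split_ifs at h with hβ
  · simpa [← hβ] using ha α h
  · exact absurd rfl h

lemma polyWeightGE_X_add_C {t : Fin M → ℝ} {j : Fin M} {a : FracRing N K}
    (ha : ∀ α, a.coeff α ≠ 0 → t j ≤ omegaHom ω α) : PolyWeightGE ω t (t j) (X j + C a) := by
  classical
  intro β α h
  rw [coeff_add, AddMonoidAlgebra.coeff_add, Finsupp.add_apply] at h
  by_cases h0 : (coeff β (C a : MvPolynomial (Fin M) (FracRing N K))).coeff α = 0
  · rw [h0, add_zero, coeff_X] at h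
    split_ifs at h with hβ
    · rw [AddMonoidAlgebra.one_def, AddMonoidAlgebra.coeff_single, Finsupp.single_apply] at h
      split_ifs at h with hα
      · rw [← hβ, ← hα, map_zero, Finset.sum_eq_single j]
        · simp
        · intro k _ hk
          rw [Finsupp.single_eq_of_ne hk]
          simp
        · simp
      · exact absurd rfl h
    · exact absurd rfl h
  · exact polyWeightGE_C ha β α h0

lemma exists_forall_le_weight (ω : Fin N → ℝ) (t : Fin M → ℝ) (f : MixedRing N M K) :
    ∃ δ : ℝ, ∀ β α, (coeff β f).coeff α ≠ 0 →
      δ ≤ omegaHom ω (scaleHom N 1 α) + ∑ j, β j * t j := by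
  classical
  obtain ⟨δ, hδ⟩ := Finset.bddBelow (f.support.biUnion fun β => (coeff β f).coeff.support.image
    fun α => omegaHom ω (scaleHom N 1 α) + ∑ j, β j * t j)
  refine ⟨δ, fun β α h => hδ (Finset.mem_coe.2 (Finset.mem_biUnion.2 ⟨β, ?_, Finset.mem_image.2 ⟨α, ?_, rfl⟩⟩))⟩
  · exact mem_support_iff.2 fun h0 => h (by rw [h0]; rfl)
  · exact Finsupp.mem_support_iff.2 h

/-- With weight `t_j` on `y_j`, adding terms of weight at least `t_j` to `y_j` cannot lower the
weight of a polynomial. The bound is therefore uniform over all partial sums. -/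
lemma polyWeightGE_shift {t : Fin M → ℝ} {δ : ℝ} {f : MixedRing N M K}
    (hf : ∀ β α, (coeff β f).coeff α ≠ 0 →
      δ ≤ omegaHom ω (scaleHom N 1 α) + ∑ j, β j * t j) {p : Fin M → FracRing N K}
    (hp : ∀ j α, (p j).coeff α ≠ 0 → t j ≤ omegaHom ω α) :
    PolyWeightGE ω t δ (eval₂ (C.comp (fracEmb N K 1)) (fun j => X j + C (p j)) f) := by
  classical
  rw [eval₂_eq']
  refine PolyWeightGE.sum _ fun β _ => ?_
  have h1 : PolyWeightGE ω t (∑ j, β j * t j) (∏ j, (X j + C (p j)) ^ β j) := by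
    refine PolyWeightGE.prod _ fun j _ => ?_
    have := PolyWeightGE.prod (Finset.range (β j)) (ω := ω) (t := t) (δ := fun _ => t j)
      (F := fun _ => X j + C (p j)) fun _ _ => polyWeightGE_X_add_C (hp j)
    simpa using this
  have h2 : PolyWeightGE ω t (δ - ∑ j, β j * t j) ((C.comp (fracEmb N K 1)) (coeff β f)) := by
    refine polyWeightGE_C fun α hα => ?_
    obtain ⟨α', h3, rfl⟩ := Finset.mem_image.1
      (Finsupp.mapDomain_support (Finsupp.mem_support_iff.2 hα))
    have := hf β α' (Finsupp.mem_support_iff.1 h3)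
    exact sub_le_iff_le_add.2 this
  have := h2.mul h1
  rwa [sub_add_cancel] at this

end PolyWeights

/-! ### The series defined by an infinite `ω`-sequence is a solution -/

section SeriesSolution

variable {N M : ℕ} {K : Type*} [Field K] {ω : Fin N → ℝ}

lemma coeff_term_eq_coeff_monomials (S : ℕ → OmegaData N M K) (i : ℕ) (j : Fin M)
    (γ : Fin N → ℚ) : ((S i).term (ramIndex S i) j).coeff γ =
      ((S i).monomials ω (ramIndex S i) j).1.coeff (toExp ω γ) := by
  rw [← coeff_fracToHahn (ω := ω), OmegaData.term, fracToHahn_single]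
  rfl

lemma coeff_partialSer (S : ℕ → OmegaData N M K) (i : ℕ) (j : Fin M) (γ : Fin N → ℚ) :
    (partialSer S i j).coeff γ = ∑ k ∈ Finset.range i,
      ((S k).monomials ω (ramIndex S k) j).1.coeff (toExp ω γ) := by
  rw [partialSer, AddMonoidAlgebra.coeff_sum, Finsupp.finsetSum_apply]
  exact Finset.sum_congr rfl fun k _ => coeff_term_eq_coeff_monomials S k j γ

/-- This truncates the infinite sum at a fixed exponent. -/
lemma serCoeff_eq_coeff_partialSer (S : ℕ → OmegaData N M K) {i : ℕ} {j : Fin M} {γ : Fin N → ℚ}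
    (h : ∀ k, i ≤ k → k ∉ contributors ω ⊤ S j (toExp ω γ)) :
    serCoeff ω ⊤ S j (toExp ω γ) = (partialSer S i j).coeff γ := by
  rw [coeff_partialSer (ω := ω), serCoeff]
  refine finsum_mem_eq_sum_of_inter_support_eq _ (Set.ext fun k => ⟨fun hk => ⟨?_, hk.2⟩,
    fun hk => ⟨⟨le_top, hk.2⟩, hk.2⟩⟩)
  by_contra h0
  exact h k (by simpa using h0) hk.1

lemma IsOmegaSequence.serCoeff_serExponent (hω : LinearIndependent ℚ ω)
    {I : Ideal (MixedRing N M K)} {S : ℕ → OmegaData N M K} (hS : IsOmegaSequence ω I ⊤ S)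
    (i : ℕ) (j : Fin M) (hc : (S i).c j ≠ 0) :
    serCoeff ω ⊤ S j (toExp ω (serExponent S i j)) ≠ 0 := by
  have hi : i ∈ contributors ω ⊤ S j (toExp ω (serExponent S i j)) :=
    ⟨le_top, (coeff_monomials_ne_zero_iff S i j _).2 ⟨hc, rfl⟩⟩
  have : contributors ω ⊤ S j (toExp ω (serExponent S i j)) = {i} :=
    (hS.contributors_subsingleton hω j _).eq_singleton_of_mem hi
  rw [serCoeff, this, finsum_mem_singleton]
  exact hi.2

/-- The weights of the terms of an infinite `ω`-sequence defining a Puiseux series tend to `∞`. -/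
lemma IsOmegaSequence.exists_forall_le_omegaHom (hω : LinearIndependent ℚ ω)
    {I : Ideal (MixedRing N M K)} {S : ℕ → OmegaData N M K} (hS : IsOmegaSequence ω I ⊤ S)
    {φ : Fin M → OmegaPuiseux K ω} (hφ : IsSeriesOf ω ⊤ S φ) (j : Fin M) (B : ℝ) :
    ∃ n, ∀ i, n ≤ i → (S i).η j ≠ ⊤ → B ≤ omegaHom ω (serExponent S i j) := by
  by_contra! hcon
  have hall : ∀ n, (S n).η j ≠ ⊤ ∧ omegaHom ω (serExponent S n j) < B := by
    intro n
    obtain ⟨i, hi, h1, h2⟩ := hcon n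
    rcases hi.eq_or_lt with rfl | hlt
    · exact ⟨h1, h2⟩
    · obtain ⟨h3, h4⟩ := hS.omegaHom_lt hω hlt le_top h1
      exact ⟨h3, h4.trans h2⟩
  have hmono : StrictMono fun n => omegaHom ω (serExponent S n j) :=
    strictMono_nat_of_lt_succ fun n => hS.omegaHom_lt_succ hω le_top (hall _).1
  refine Set.infinite_of_injective_forall_mem (f := fun n => toExp ω (serExponent S n j))
    (fun a b hab => hmono.injective (congrArg (omegaHom ω) hab)) (fun n => ?_)
    (IsOmegaPuiseuxSupport.finite_omegaDot_le hω (φ j).2 B)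
  refine ⟨?_, (hall n).2.le⟩
  change (φ j).1.coeff _ ≠ 0
  rw [(hφ j _).2]
  exact hS.serCoeff_serExponent hω n j (((hS.1 n le_top).1.2.2 j).2 (hall n).1)

/-- A tuple of Puiseux series defined by an infinite `ω`-sequence is a solution. -/
theorem IsOmegaSequence.isOmegaSolution (hω : LinearIndependent ℚ ω)
    {I : Ideal (MixedRing N M K)} {S : ℕ → OmegaData N M K} (hS : IsOmegaSequence ω I ⊤ S)
    {φ : Fin M → OmegaPuiseux K ω} (hφ : IsSeriesOf ω ⊤ S φ) : IsOmegaSolution ω I φ := by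
  classical
  rw [isOmegaSolution_iff]
  intro f hf
  by_contra hne
  set g := (fracToHahn K ω).comp (fracEmb N K 1) with hg
  obtain ⟨γ₀, hγ₀, hmin⟩ := HahnSeries.exists_omegaHom_le hne
  set t : Fin M → ℝ := fun j => omegaHom ω (serExponent S 0 j) with ht
  obtain ⟨δ, hδ⟩ := exists_forall_le_weight ω t f
  -- An error of relative weight `B` in the arguments moves the value of `f` only at weights at
  -- least `δ + B`, beyond that of `γ₀`.
  set B : ℝ := |omegaHom ω γ₀ - δ| + 1 with hB
  have hBpos : omegaHom ω γ₀ < δ + B := by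
    have := le_abs_self (omegaHom ω γ₀ - δ)
    linarith
  have hB0 : 0 ≤ B := by positivity
  obtain ⟨n, hn⟩ : ∃ n, ∀ j i, n ≤ i → (S i).η j ≠ ⊤ →
      t j + B ≤ omegaHom ω (serExponent S i j) := by
    choose n hn using fun j => hS.exists_forall_le_omegaHom hω hφ j (t j + B)
    refine ⟨Finset.univ.sup n, fun j i hi => hn j i ((Finset.le_sup (Finset.mem_univ j)).trans hi)⟩
  have hterm : ∀ j i, (S i).η j ≠ ⊤ → t j ≤ omegaHom ω (serExponent S i j) := by
    intro j i hi
    rcases Nat.eq_zero_or_pos i with rfl | h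
    · exact le_rfl
    · exact (hS.omegaHom_lt hω h le_top hi).2.le
  have hcontr : ∀ j (γ : OmegaExp ω) k, k ∈ contributors ω ⊤ S j γ →
      (S k).η j ≠ ⊤ ∧ γ = toExp ω (serExponent S k j) := by
    intro j γ k hk
    obtain ⟨h1, h2⟩ := (coeff_monomials_ne_zero_iff S k j γ).1 hk.2
    exact ⟨((hS.1 k le_top).1.2.2 j).1 h1, h2⟩
  have hφw : ∀ j, WeightGE (t j) (φ j).1 := by
    intro j γ hγ
    rw [(hφ j γ).2] at hγ
    by_contra hlt
    refine hγ ((serCoeff_eq_coeff_partialSer S (i := 0) fun k _ hk => hlt ?_).trans (by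
      rw [partialSer, Finset.range_zero, Finset.sum_empty]; rfl))
    obtain ⟨h1, h2⟩ := hcontr j _ k hk
    change t j ≤ omegaHom ω (toExp ω γ)
    change toExp ω γ = _ at h2
    rw [h2]
    exact hterm j k h1
  have hpw : ∀ i j α, (partialSer S i j).coeff α ≠ 0 → t j ≤ omegaHom ω α := by
    intro i j α hα
    rw [coeff_partialSer (ω := ω)] at hα
    obtain ⟨k, -, hk⟩ := Finset.exists_ne_zero_of_sum_ne_zero hα
    obtain ⟨h1, h2⟩ := hcontr j _ k ⟨le_top, hk⟩
    have h3 : α = serExponent S k j := h2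
    rw [h3]
    exact hterm j k h1
  have hpw' : ∀ i j, WeightGE (t j) (fracToHahn K ω (partialSer S i j)) := by
    intro i j γ hγ
    exact hpw i j γ fun h0 => hγ ((coeff_fracToHahn _ _).trans h0)
  have hdiff : ∀ i, n ≤ i → ∀ j,
      WeightGE (t j + B) ((φ j).1 - fracToHahn K ω (partialSer S i j)) := by
    intro i hi j γ hγ
    rw [HahnSeries.coeff_sub, (hφ j γ).2] at hγ
    by_contra hlt
    refine hγ (sub_eq_zero.2 ((serCoeff_eq_coeff_partialSer S (i := i) fun k hk hkc =>
      hlt ?_).trans (coeff_fracToHahn _ _).symm))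
    obtain ⟨h1, h2⟩ := hcontr j _ k hkc
    change t j + B ≤ omegaHom ω (toExp ω γ)
    change toExp ω γ = _ at h2
    rw [h2]
    exact hn j k (hi.trans hk) h1
  have hclose : ∀ i, n ≤ i → ∀ γ : OmegaExp ω, omegaHom ω γ ≤ omegaHom ω γ₀ →
      (eval₂ (fracEmb N K 1) (partialSer S i) f).coeff γ =
        (eval₂ g (fun j => (φ j).1) f).coeff γ := by
    intro i hi γ hγ
    have h1 : (eval₂ (fracEmb N K 1) (partialSer S i) f).coeff γ =
        (eval₂ g (fun j => fracToHahn K ω (partialSer S i j)) f).coeff γ := by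
      have := eval₂_comp_left (fracToHahn K ω) (fracEmb N K 1) (partialSer S i) f
      change _ = eval₂ g (fun j => fracToHahn K ω (partialSer S i j)) f at this
      rw [← this]
      exact (coeff_fracToHahn _ _).symm
    rw [h1]
    by_contra h2
    obtain ⟨β, α, h3, -, h4⟩ := exists_of_coeff_eval₂_sub_ne_zero f hφw (hpw' i) (hdiff i hi)
      (γ := γ) (r := 1) (by
        rw [HahnSeries.coeff_sub]
        exact sub_ne_zero.2 (Ne.symm h2))
    have := hδ β α h3
    linarith
  -- The coefficient at `γ₀` survives in `f(x, p_{n+1})`, so cancellation at stage `n` yields a term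
  -- of `f(x, y + p_n)` of smaller weight. Both types of term are impossible.
  have hγ₁ : (eval₂ (fracEmb N K 1) (partialSer S (n + 1)) f).coeff γ₀ ≠ 0 := by
    rw [hclose (n + 1) (by omega) γ₀ le_rfl]
    exact hγ₀
  obtain ⟨β, α, h1, h2, h3⟩ := hS.exists_lt hω le_top hf hγ₁
  rw [map_add, map_sum] at h3
  simp only [map_nsmul] at h3
  simp only [nsmul_eq_mul] at h3
  -- A term free of `y` is a term of `f(x, p_n)`, hence of `f(x, φ)`, lighter than the minimum `γ₀`.
  -- A term involving some `y_j` has weight at least `δ + B`, because the `n`-th exponent there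
  -- exceeds `t_j` by at least `B`.
  by_cases hβ : β = 0
  · subst hβ
    simp only [Finsupp.coe_zero, Pi.zero_apply, Nat.cast_zero, zero_mul, Finset.sum_const_zero,
      add_zero] at h3
    have h4 : coeff 0 (shiftedPoly S f n) = eval₂ (fracEmb N K 1) (partialSer S n) f := by
      rw [← constantCoeff_eq, shiftedPoly, eval₂_comp_left constantCoeff]
      congr 1
      · ext <;> simp
      · funext j
        simp
    rw [h4] at h1
    have h5 := hclose n le_rfl α h3.le
    exact absurd (hmin α (fun h0 => h1 (h5.trans h0))) (not_le.2 h3)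
  · have h4 := polyWeightGE_shift hδ (hpw n) β α h1
    obtain ⟨j, hj⟩ := Finsupp.ne_iff.1 hβ
    have hj1 : (1 : ℝ) ≤ β j := by exact_mod_cast Nat.one_le_iff_ne_zero.2 hj
    have h5 : ∑ k, (β k : ℝ) * t k + B ≤ ∑ k, (β k : ℝ) * omegaHom ω (serExponent S n k) := by
      rw [← Finset.add_sum_erase _ _ (Finset.mem_univ j),
        ← Finset.add_sum_erase (f := fun k => (β k : ℝ) * omegaHom ω (serExponent S n k))
          (h := Finset.mem_univ j)]
      have h6 := hn j n le_rfl fun h => hj (h2 j h)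
      have h7 : ∑ k ∈ Finset.univ.erase j, (β k : ℝ) * t k ≤
          ∑ k ∈ Finset.univ.erase j, (β k : ℝ) * omegaHom ω (serExponent S n k) := by
        refine Finset.sum_le_sum fun k _ => ?_
        by_cases hk : (S n).η k = ⊤
        · simp [h2 k hk]
        · exact mul_le_mul_of_nonneg_left (hterm k n hk) (Nat.cast_nonneg _)
      nlinarith
    linarith

end SeriesSolution

/-! ### The `ω`-sequence of a solution -/

section SolutionSequence

variable {N M : ℕ} {K : Type*} [Field K] {ω : Fin N → ℝ}

open Classical in
/-- The exponent of least weight of a nonzero series. -/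
def leadExp (a : HahnSeries (OmegaExp ω) K) : Fin N → ℚ :=
  if h : ∃ γ : Fin N → ℚ, a.coeff (toExp ω γ) ≠ 0 ∧ WeightGE (omegaHom ω γ) a then h.choose else 0

lemma leadExp_spec {a : HahnSeries (OmegaExp ω) K} (ha : a ≠ 0) :
    a.coeff (toExp ω (leadExp a)) ≠ 0 ∧ WeightGE (omegaHom ω (leadExp a)) a := by
  have h : ∃ γ : Fin N → ℚ, a.coeff (toExp ω γ) ≠ 0 ∧ WeightGE (omegaHom ω γ) a :=
    HahnSeries.exists_omegaHom_le ha
  rw [leadExp, dif_pos h]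
  exact h.choose_spec

/-- The coefficient of a series at its exponent of least weight. -/
def leadCoeff (a : HahnSeries (OmegaExp ω) K) : K := a.coeff (toExp ω (leadExp a))

lemma leadCoeff_ne_zero {a : HahnSeries (OmegaExp ω) K} (ha : a ≠ 0) : leadCoeff a ≠ 0 :=
  (leadExp_spec ha).1

lemma weightGE_leadExp {a : HahnSeries (OmegaExp ω) K} (ha : a ≠ 0) :
    WeightGE (omegaHom ω (leadExp a)) a :=
  (leadExp_spec ha).2

/-- A series without its term of least weight. -/
def removeLead (a : HahnSeries (OmegaExp ω) K) : HahnSeries (OmegaExp ω) K :=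
  a - HahnSeries.single (toExp ω (leadExp a)) (leadCoeff a)

lemma removeLead_zero : removeLead (0 : HahnSeries (OmegaExp ω) K) = 0 := by
  simp [removeLead, leadCoeff]

lemma coeff_removeLead_of_ne {a : HahnSeries (OmegaExp ω) K} {γ : OmegaExp ω}
    (h : γ ≠ toExp ω (leadExp a)) : (removeLead a).coeff γ = a.coeff γ := by
  rw [removeLead, HahnSeries.coeff_sub, HahnSeries.coeff_single_of_ne h, sub_zero]

lemma coeff_removeLead_self (a : HahnSeries (OmegaExp ω) K) :
    (removeLead a).coeff (toExp ω (leadExp a)) = 0 := by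
  rw [removeLead, HahnSeries.coeff_sub, HahnSeries.coeff_single_same, leadCoeff, sub_self]

lemma lt_of_coeff_removeLead_ne_zero (hω : LinearIndependent ℚ ω)
    {a : HahnSeries (OmegaExp ω) K} {γ : OmegaExp ω} (h : (removeLead a).coeff γ ≠ 0) :
    a.coeff γ ≠ 0 ∧ omegaHom ω (leadExp a) < omegaHom ω γ := by
  have hne : γ ≠ toExp ω (leadExp a) := fun h0 => h (h0 ▸ coeff_removeLead_self a)
  rw [coeff_removeLead_of_ne hne] at h
  have ha : a ≠ 0 := by
    rintro rfl
    exact h rfl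
  exact ⟨h, lt_of_le_of_ne (weightGE_leadExp ha γ h) fun h0 => hne (omegaHom_injective hω h0).symm⟩

/-- The successive tails of a series. -/
def tailSeq (a : HahnSeries (OmegaExp ω) K) (i : ℕ) : HahnSeries (OmegaExp ω) K := removeLead^[i] a

lemma tailSeq_succ (a : HahnSeries (OmegaExp ω) K) (i : ℕ) :
    tailSeq a (i + 1) = removeLead (tailSeq a i) :=
  Function.iterate_succ_apply' _ _ _

lemma tailSeq_ne_zero {a : HahnSeries (OmegaExp ω) K} {i : ℕ} (h : tailSeq a (i + 1) ≠ 0) :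
    tailSeq a i ≠ 0 := by
  intro h0
  rw [tailSeq_succ, h0, removeLead_zero] at h
  exact h rfl

lemma omegaHom_leadExp_lt (hω : LinearIndependent ℚ ω) {a : HahnSeries (OmegaExp ω) K} {i : ℕ}
    (h : tailSeq a (i + 1) ≠ 0) :
    omegaHom ω (leadExp (tailSeq a i)) < omegaHom ω (leadExp (tailSeq a (i + 1))) := by
  rw [tailSeq_succ] at h ⊢
  exact (lt_of_coeff_removeLead_ne_zero hω (leadCoeff_ne_zero h)).2

lemma coeff_ne_zero_of_coeff_tailSeq_ne_zero (hω : LinearIndependent ℚ ω)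
    {a : HahnSeries (OmegaExp ω) K} {i : ℕ} {γ : OmegaExp ω} (h : (tailSeq a i).coeff γ ≠ 0) :
    a.coeff γ ≠ 0 := by
  induction i with
  | zero => exact h
  | succ i ih =>
    rw [tailSeq_succ] at h
    exact ih (lt_of_coeff_removeLead_ne_zero hω h).1

/-- Every exponent is eventually below the exponents of the tails of a Puiseux series. -/
lemma exists_tailSeq_eq_zero_or_lt (hω : LinearIndependent ℚ ω) (a : OmegaPuiseux K ω) (t : ℝ) :
    ∃ i, ∀ k, i ≤ k → tailSeq a.1 k = 0 ∨ t < omegaHom ω (leadExp (tailSeq a.1 k)) := by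
  by_contra! hcon
  have hmono : ∀ k i, tailSeq a.1 (i + k) ≠ 0 → tailSeq a.1 i ≠ 0 ∧
      omegaHom ω (leadExp (tailSeq a.1 i)) ≤ omegaHom ω (leadExp (tailSeq a.1 (i + k))) := by
    intro k i
    induction k with
    | zero => exact fun h => ⟨h, le_rfl⟩
    | succ k ih =>
      intro h
      obtain ⟨h1, h2⟩ := ih (tailSeq_ne_zero h)
      exact ⟨h1, h2.trans (omegaHom_leadExp_lt hω h).le⟩
  -- Leading weights increase along the tails, so if the bound `t` is respected infinitely often it
  -- is always respected. This gives infinitely many exponents of `a` of bounded weight.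
  have hall : ∀ i, tailSeq a.1 i ≠ 0 ∧ omegaHom ω (leadExp (tailSeq a.1 i)) ≤ t := by
    intro i
    obtain ⟨k, hk, h1, h2⟩ := hcon i
    obtain ⟨k, rfl⟩ := Nat.exists_eq_add_of_le hk
    obtain ⟨h3, h4⟩ := hmono k i h1
    exact ⟨h3, h4.trans h2⟩
  have hinc : StrictMono fun i => omegaHom ω (leadExp (tailSeq a.1 i)) :=
    strictMono_nat_of_lt_succ fun i => omegaHom_leadExp_lt hω (hall _).1
  refine Set.infinite_of_injective_forall_mem (f := fun i => toExp ω (leadExp (tailSeq a.1 i)))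
    (fun i k h => hinc.injective (congrArg (omegaHom ω) h)) (fun i => ?_)
    (IsOmegaPuiseuxSupport.finite_omegaDot_le hω a.2 t)
  refine ⟨?_, (hall i).2⟩
  exact coeff_ne_zero_of_coeff_tailSeq_ne_zero hω (leadCoeff_ne_zero (hall i).1)

open Classical in
/-- The `ω`-set of the leading terms of a tuple of series in `x ^ {r I}`. -/
def leadData (r : ℚ) (τ : Fin M → HahnSeries (OmegaExp ω) K) : OmegaData N M K where
  η j := if τ j = 0 then ⊤ else ((omegaHom ω (r⁻¹ • leadExp (τ j)) : ℝ) : WithTop ℝ)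
  Γ j l := if τ j = 0 then ⊤ else (((r⁻¹ • leadExp (τ j)) l : ℚ) : WithTop ℚ)
  c j := leadCoeff (τ j)

lemma leadData_eta_eq_top {r : ℚ} {τ : Fin M → HahnSeries (OmegaExp ω) K} {j : Fin M} :
    (leadData r τ).η j = ⊤ ↔ τ j = 0 := by
  simp only [leadData]
  split_ifs with h <;> simp [h]

lemma leadData_eta {r : ℚ} {τ : Fin M → HahnSeries (OmegaExp ω) K} {j : Fin M} (h : τ j ≠ 0) :
    (leadData r τ).η j = ((omegaHom ω (r⁻¹ • leadExp (τ j)) : ℝ) : WithTop ℝ) :=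
  if_neg h

lemma leadData_exponent {r : ℚ} (hr : r ≠ 0) {τ : Fin M → HahnSeries (OmegaExp ω) K} {j : Fin M}
    (h : τ j ≠ 0) : r • (leadData r τ).exponent j = leadExp (τ j) := by
  have : (leadData r τ).exponent j = r⁻¹ • leadExp (τ j) := by
    ext l
    simp [OmegaData.exponent, leadData, h]
  rw [this, smul_inv_smul₀ hr]

lemma isOmegaSet_leadData (hN : 0 < N) (hω : LinearIndependent ℚ ω) (r : ℚ)
    (τ : Fin M → HahnSeries (OmegaExp ω) K) : IsOmegaSet ω (leadData r τ) := by
  refine ⟨fun j => ?_, fun j hj l => if_pos (leadData_eta_eq_top.1 hj), fun j => ?_⟩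
  · by_cases h : τ j = 0
    · rw [leadData_eta_eq_top.2 h]
      -- A row of entries `∞` has sum `∞` only if it is nonempty, whence `N ≥ 1`.
      refine WithTop.sum_eq_top.2 ⟨⟨0, hN⟩, Finset.mem_univ _, ?_⟩
      simp only [leadData, if_pos h, WithTop.map_top]
      exact WithTop.mul_top (by exact_mod_cast hω.ne_zero _)
    · rw [leadData_eta h]
      change _ = ((∑ l, ω l * (((r⁻¹ • leadExp (τ j)) l : ℚ) : ℝ) : ℝ) : WithTop ℝ)
      rw [WithTop.coe_sum]
      refine Finset.sum_congr rfl fun l _ => ?_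
      simp only [leadData, if_neg h, WithTop.map_coe, WithTop.coe_mul]
  · rw [Ne, Ne, leadData_eta_eq_top, not_iff_not]
    refine ⟨fun h => ?_, fun h => ?_⟩
    · by_contra h0
      exact leadCoeff_ne_zero h0 h
    · simp [leadData, leadCoeff, h]

lemma fracToHahn_leadData_term {r : ℚ} (hr : r ≠ 0) (τ : Fin M → HahnSeries (OmegaExp ω) K)
    (j : Fin M) : fracToHahn K ω ((leadData r τ).term r j) = τ j - removeLead (τ j) := by
  rw [removeLead, sub_sub_cancel, OmegaData.term, fracToHahn_single]
  by_cases h : τ j = 0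
  · simp [leadData, leadCoeff, h]
  · rw [leadData_exponent hr h]
    rfl

/-- The leading terms of a solution form a starting `ω`-set. -/
lemma isStartingOmegaSet_leadData (hN : 0 < N) (hω : LinearIndependent ℚ ω)
    {I : Ideal (MixedRing N M K)} {r : ℚ} (hr : 0 < r) {τ : Fin M → HahnSeries (OmegaExp ω) K}
    (hτ : ∀ f ∈ I, eval₂ ((fracToHahn K ω).comp (fracEmb N K r)) τ f = 0) :
    IsStartingOmegaSet ω I (leadData r τ) := by
  have hD := isOmegaSet_leadData hN hω r τ
  refine isStartingOmegaSet_of_cancelsInitial hω hD hr fun f hf γ hγ => ?_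
  set t : Fin M → ℝ := fun j => omegaHom ω (r • (leadData r τ).exponent j) with ht
  have htj : ∀ j, τ j ≠ 0 → t j = omegaHom ω (leadExp (τ j)) := fun j hj => by
    rw [ht]
    exact congrArg (omegaHom ω) (leadData_exponent hr.ne' hj)
  -- A common gap between leading terms and remainders. It is obtained as an eventual property at
  -- `0⁺`, which also covers `M = 0`.
  obtain ⟨ε, hε, h⟩ : ∃ ε : ℝ, 0 < ε ∧ ∀ j, WeightGE (t j + ε) (removeLead (τ j)) := by
    have hj : ∀ j, ∃ ε : ℝ, 0 < ε ∧ WeightGE (t j + ε) (removeLead (τ j)) := by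
      intro j
      by_cases h0 : removeLead (τ j) = 0
      · exact ⟨1, one_pos, h0 ▸ weightGE_zero _⟩
      · obtain ⟨γ', h1, h2⟩ := HahnSeries.exists_omegaHom_le h0
        have hτ0 : τ j ≠ 0 := fun h => h0 (by rw [h, removeLead_zero])
        refine ⟨omegaHom ω γ' - t j, ?_, by rwa [add_sub_cancel]⟩
        rw [htj j hτ0]
        exact sub_pos.2 (lt_of_coeff_removeLead_ne_zero hω h1).2
    choose ε hε h using hj
    have hev : ∀ᶠ e in nhdsWithin (0 : ℝ) (Set.Ioi 0), ∀ j, e ≤ ε j :=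
      Filter.eventually_all.2 fun j => nhdsWithin_le_nhds (Iic_mem_nhds (hε j))
    obtain ⟨e, he, he0⟩ := (hev.and self_mem_nhdsWithin).exists
    exact ⟨e, he0, fun j => (h j).mono (by linarith [he j])⟩
  have hτw : ∀ j, WeightGE (t j) (τ j) := by
    intro j
    by_cases h0 : τ j = 0
    · exact h0 ▸ weightGE_zero _
    · rw [htj j h0]
      exact weightGE_leadExp h0
  set u : Fin M → HahnSeries (OmegaExp ω) K :=
    fun j => fracToHahn K ω ((leadData r τ).term r j) with hu
  have huw : ∀ j, WeightGE (t j) (u j) := by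
    intro j
    simp only [hu, OmegaData.term, fracToHahn_single]
    exact weightGE_single _ _
  have hdiff : ∀ j, WeightGE (t j + ε) (τ j - u j) := by
    intro j
    simp only [hu, fracToHahn_leadData_term hr.ne', sub_sub_cancel]
    exact h j
  -- As `f` vanishes at `τ`, its value at the leading terms `u` is minus the difference of the two
  -- values, and every exponent of that difference gains at least `ε` over a term of `f`.
  have h1 : (eval₂ ((fracToHahn K ω).comp (fracEmb N K r)) τ f -
      eval₂ ((fracToHahn K ω).comp (fracEmb N K r)) u f).coeff (toExp ω γ) ≠ 0 := by
    have h2 := eval₂_comp_left (fracToHahn K ω) (fracEmb N K r) ((leadData r τ).term r) f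
    change _ = eval₂ _ u f at h2
    rw [hτ f hf, zero_sub, HahnSeries.coeff_neg, ← h2, coeff_fracToHahn]
    exact neg_ne_zero.2 hγ
  obtain ⟨β, α, h2, h3, h4⟩ := exists_of_coeff_eval₂_sub_ne_zero f hτw huw hdiff h1
  have hβ : ∏ j, (leadData r τ).c j ^ β j ≠ 0 := by
    refine Finset.prod_ne_zero_iff.2 fun j _ => ?_
    by_cases h0 : τ j = 0
    · have : u j = 0 := by
        simp only [hu, fracToHahn_leadData_term hr.ne', h0, removeLead_zero, sub_zero]
      rw [h3 j h0 this, pow_zero]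
      exact one_ne_zero
    · exact pow_ne_zero _ (leadCoeff_ne_zero h0)
  refine ⟨β, α, h2, _, hD.mixedWeight_eq hω α hβ, ?_⟩
  rw [← omegaHom_smul, OmegaData.totalExponent, smul_add, map_add, Finset.smul_sum, map_sum]
  have h5 : ∑ j, omegaHom ω (r • β j • (leadData r τ).exponent j) = ∑ j, (β j : ℝ) * t j := by
    refine Finset.sum_congr rfl fun j _ => ?_
    rw [smul_comm, map_nsmul, nsmul_eq_mul]
  rw [h5]
  change omegaHom ω (scaleHom N r α) + _ < _
  exact lt_of_lt_of_le (by linarith) h4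

/-- The ramification indices of the `ω`-sequence of a solution. -/
def solutionRam (φ : Fin M → HahnSeries (OmegaExp ω) K) : ℕ → ℚ
  | 0 => 1
  | i + 1 => solutionRam φ i / (leadData (solutionRam φ i) fun j => tailSeq (φ j) i).d

/-- The `ω`-sequence of a solution. -/
def solutionSeq (φ : Fin M → HahnSeries (OmegaExp ω) K) (i : ℕ) : OmegaData N M K :=
  leadData (solutionRam φ i) fun j => tailSeq (φ j) i

/-- The recursion `solutionRam` breaks a circularity: the exponents of the `i`-th `ω`-set depend on
the earlier denominators. -/
lemma ramIndex_solutionSeq (φ : Fin M → HahnSeries (OmegaExp ω) K) (i : ℕ) :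
    ramIndex (solutionSeq φ) i = solutionRam φ i := by
  induction i with
  | zero => exact ramIndex_zero _
  | succ i ih =>
    have h := ramIndex_succ (solutionSeq φ) i
    rw [ih] at h
    rw [solutionRam, eq_div_iff (Nat.cast_ne_zero.2 (OmegaData.d_pos _).ne')]
    exact h

lemma solutionSeq_eq (φ : Fin M → HahnSeries (OmegaExp ω) K) (i : ℕ) :
    solutionSeq φ i = leadData (ramIndex (solutionSeq φ) i) fun j => tailSeq (φ j) i := by
  rw [ramIndex_solutionSeq]
  rfl

lemma fracToHahn_solutionSeq_term (φ : Fin M → HahnSeries (OmegaExp ω) K) (i : ℕ) (j : Fin M) :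
    fracToHahn K ω ((solutionSeq φ i).term (ramIndex (solutionSeq φ) i) j) =
      tailSeq (φ j) i - tailSeq (φ j) (i + 1) := by
  rw [ramIndex_solutionSeq, tailSeq_succ, solutionSeq,
    fracToHahn_leadData_term (ramIndex_solutionSeq φ i ▸ (ramIndex_pos _ i).ne')]

/-- The substitution adds the removed leading term back to the next tail, so a zero of the current
ideal yields a zero of the transformed one. -/
lemma eval₂_tailSeq_eq_zero {I : Ideal (MixedRing N M K)}
    {φ : Fin M → HahnSeries (OmegaExp ω) K}
    (hφ : ∀ f ∈ I, eval₂ ((fracToHahn K ω).comp (fracEmb N K 1)) φ f = 0) (i : ℕ) :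
    ∀ f ∈ idealSeq I (solutionSeq φ) i,
      eval₂ ((fracToHahn K ω).comp (fracEmb N K (ramIndex (solutionSeq φ) i)))
        (fun j => tailSeq (φ j) i) f = 0 := by
  induction i with
  | zero =>
    rw [ramIndex_zero]
    exact hφ
  | succ i ih =>
    have hle : idealSeq I (solutionSeq φ) (i + 1) ≤ RingHom.ker
        (eval₂Hom ((fracToHahn K ω).comp (fracEmb N K (ramIndex (solutionSeq φ) (i + 1))))
          (fun j => tailSeq (φ j) (i + 1))) := by
      refine Ideal.span_le.2 ?_
      rintro _ ⟨f, hf, rfl⟩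
      rw [SetLike.mem_coe, RingHom.mem_ker, coe_eval₂Hom, OmegaData.eval₂_subst, ramIndex_succ,
        ← ih f hf]
      congr 1
      funext j
      rw [fracToHahn_solutionSeq_term, add_sub_cancel]
    exact fun f hf => hle hf

lemma isOmegaSequence_solutionSeq (hN : 0 < N) (hω : LinearIndependent ℚ ω)
    {I : Ideal (MixedRing N M K)} {φ : Fin M → HahnSeries (OmegaExp ω) K}
    (hφ : ∀ f ∈ I, eval₂ ((fracToHahn K ω).comp (fracEmb N K 1)) φ f = 0) :
    IsOmegaSequence ω I ⊤ (solutionSeq φ) := by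
  refine ⟨fun i _ => ?_, fun i _ j hj => ?_⟩
  · rw [solutionSeq_eq]
    exact isStartingOmegaSet_leadData hN hω (ramIndex_pos _ i) (eval₂_tailSeq_eq_zero hφ i)
  · have h1 : tailSeq (φ j) (i + 1) ≠ 0 := fun h => hj (leadData_eta_eq_top.2 h)
    have hr : (0 : ℝ) < (ramIndex (solutionSeq φ) (i + 1) : ℝ)⁻¹ :=
      inv_pos.2 (Rat.cast_pos.2 (ramIndex_pos _ (i + 1)))
    have hd : ((solutionSeq φ i).d : ℝ) ≠ 0 := Nat.cast_ne_zero.2 (OmegaData.d_pos _).ne'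
    have h2 : (solutionSeq φ i).η j = _ := leadData_eta (tailSeq_ne_zero h1)
    have h3 : (solutionSeq φ (i + 1)).η j = _ := leadData_eta h1
    rw [h2, h3, ← WithTop.coe_mul, WithTop.coe_lt_coe, omegaHom_smul, omegaHom_smul,
      ← ramIndex_solutionSeq, ← ramIndex_solutionSeq, ← ramIndex_succ]
    push_cast
    rw [mul_inv, ← mul_assoc, mul_comm _ ((solutionSeq φ i).d : ℝ)⁻¹, mul_inv_cancel_left₀ hd]
    exact mul_lt_mul_of_pos_left (omegaHom_leadExp_lt hω h1) hr

lemma fracToHahn_partialSer_solutionSeq (φ : Fin M → HahnSeries (OmegaExp ω) K) (i : ℕ)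
    (j : Fin M) : fracToHahn K ω (partialSer (solutionSeq φ) i j) = φ j - tailSeq (φ j) i := by
  induction i with
  | zero => simp [partialSer, tailSeq]
  | succ i ih =>
    rw [partialSer_succ, map_add, ih, fracToHahn_solutionSeq_term, sub_add_sub_cancel]

/-- A solution is the tuple of series defined by its `ω`-sequence. -/
theorem isSeriesOf_solutionSeq (hN : 0 < N) (hω : LinearIndependent ℚ ω)
    {I : Ideal (MixedRing N M K)} {φ : Fin M → OmegaPuiseux K ω}
    (hφ : ∀ f ∈ I, eval₂ ((fracToHahn K ω).comp (fracEmb N K 1)) (fun j => (φ j).1) f = 0) :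
    IsSeriesOf ω ⊤ (solutionSeq fun j => (φ j).1) φ := by
  intro j γ
  have hS := isOmegaSequence_solutionSeq hN hω hφ
  refine ⟨(hS.contributors_subsingleton hω j γ).finite, ?_⟩
  -- From this `i` on, nonzero tails start strictly above `γ`: later terms of the sequence do not
  -- contribute to `γ`, and neither does the remainder `tailSeq (φ j) i`.
  obtain ⟨i, hi⟩ := exists_tailSeq_eq_zero_or_lt hω (φ j) (omegaHom ω γ)
  have h1 : serCoeff ω ⊤ (solutionSeq fun j => (φ j).1) j γ =
      (partialSer (solutionSeq fun j => (φ j).1) i j).coeff γ := by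
    refine serCoeff_eq_coeff_partialSer _ fun k hk hc => ?_
    obtain ⟨hc1, hc2⟩ := (coeff_monomials_ne_zero_iff _ k j _).1 hc.2
    have h0 : tailSeq (φ j).1 k ≠ 0 := fun h =>
      (((hS.1 k le_top).1.2.2 j).1 hc1) (leadData_eta_eq_top.2 h)
    have h2 : serExponent (solutionSeq fun j => (φ j).1) k j = leadExp (tailSeq (φ j).1 k) := by
      rw [serExponent, ramIndex_solutionSeq, solutionSeq]
      exact leadData_exponent (ramIndex_solutionSeq (fun j => (φ j).1) k ▸
        (ramIndex_pos _ k).ne') h0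
    have h3 : γ = toExp ω (leadExp (tailSeq (φ j).1 k)) := hc2.trans (congrArg (toExp ω) h2)
    refine absurd ((hi k hk).resolve_left h0) ?_
    rw [h3]
    exact lt_irrefl _
  have h2 : (tailSeq (φ j).1 i).coeff γ = 0 := by
    rcases hi i le_rfl with h | h
    · rw [h]
      rfl
    · by_contra h0
      refine absurd (weightGE_leadExp (a := tailSeq (φ j).1 i) ?_ γ h0) (not_le.2 h)
      intro h4
      rw [h4] at h0
      exact h0 rfl
  rw [h1]
  have h3 := coeff_fracToHahn (ω := ω) (partialSer (solutionSeq fun j => (φ j).1) i j) γ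
  rw [← h3, fracToHahn_partialSer_solutionSeq, HahnSeries.coeff_sub]
  exact ((congrArg ((φ j).1.coeff γ - ·) h2).trans (sub_zero _)).symm

end SolutionSequence

end

/-! ### The main theorem. -/

theorem mainTheorem3 {K : Type*} [Field K] [IsAlgClosed K] [CharZero K] {N M : ℕ} (hN : 0 < N)
    (ω : Fin N → ℝ) (hω : LinearIndependent ℚ ω)
    (I : Ideal (MixedRing N M K)) (hI : IsLaurentAdmissible I) :
    (∀ (L : ℕ∞) (S : ℕ → OmegaData N M K), IsOmegaSequence ω I L S →
      ∃ φ : Fin M → OmegaPuiseux K ω, IsSeriesOf ω L S φ) ∧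
    ∀ φ : Fin M → OmegaPuiseux K ω,
      IsOmegaSolution ω I φ ↔
        ∃ S : ℕ → OmegaData N M K, IsOmegaSequence ω I ⊤ S ∧ IsSeriesOf ω ⊤ S φ := by
  refine ⟨fun L S hS => hS.exists_isSeriesOf hω hI, fun φ => ⟨fun h => ?_, ?_⟩⟩
  · rw [isOmegaSolution_iff] at h
    exact ⟨_, isOmegaSequence_solutionSeq hN hω h, isSeriesOf_solutionSeq hN hω h⟩
  · rintro ⟨S, hS, hφ⟩
    exact hS.isOmegaSolution hω hφ
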